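/- **Conventions.** A $C^*$-quantum groupoid (weak Hopf $C^*$-algebra) is a collection $(A,\Delta,\kappa,\epsilon)$ where $A$ is a finite-dimensional $C^*$-algebra with unit $1$, $\Delta:A\to A\otimes A$ is a (not necessarily unital) $*$-homomorphism with $(\Delta\otimes i)\Delta=(i\otimes\Delta)\Delta$, $\kappa:A\to A$ is a linear anti-multiplicative map with $(\kappa\circ *)^2=i$, $(\kappa\otimes\kappa)\Delta=\varsigma\Delta\kappa$ ($\varsigma$ the flip) and $(m(\kappa\otimes i)\otimes i)(\Delta\otimes i)\Delta(x)=(1\otimes x)\Delta(1)$ for all $x\in A$ ($m$ the multiplication), and $\epsilon$ is a positive linear form on $A$ with $(\epsilon\otimes i)\Delta=(i\otimes\epsilon)\Delta=i$ and $(\epsilon\otimes\epsilon)((x\otimes1)\Delta(1)(1\otimes y))=\epsilon(xy)$ for all $x,y\in A$. Its target and source Cartan subalgebras are $$A_t=\{x\in A:\Delta(x)=\Delta(1)(x\otimes1)=(x\otimes1)\Delta(1)\},\qquad A_s=\{x\in A:\Delta(x)=\Delta(1)(1\otimes x)=(1\otimes x)\Delta(1)\}.$$ For matrix units $(e^\gamma_{i,j})_{1\le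 i,j\le n_\gamma}$ of $A_t\cong\bigoplus_\gamma M_{n_\gamma}(\mathbb C)$, the canonical conditional expectation of $A_t$ onto its center is $E_{Z(A_t)}(x)=\sum_{\gamma,i,j}\frac1{n_\gamma}e^\gamma_{i,j}\,x\,e^\gamma_{j,i}$ (independent of the matrix units). The canonical element of $(A,\Delta,\kappa,\epsilon)$ is the unique invertible $q\in A_t$ such that 1. $\Delta(1)=\sum_{\gamma,i,j}\frac1{n_\gamma}\kappa^{-1}(e^\gamma_{i,j}q)\otimes e^\gamma_{j,i}$ for all matrix units $(e^\gamma_{i,j})$ of $A_t$; 2. $\kappa^2(q)=q$ and $E_{Z(A_t)}(q)=1$; 3. $\kappa^2(x)=q^{-1}\kappa(q)\,x\,q\,\kappa(q^{-1})$ for all $x$ in the algebra generated by $A_t$ and $A_s$; 4. $q$ is positive. Property 1, for a single system of matrix units, already determines $q$ in $A_t$. **Theorem 2.6.** Let $(A,\Delta,\kappa,\epsilon)$ be a $C^*$-quantum groupoid with canonical element $q$, and let $k$ be a positive invertible element of $A_t$ with $\kappa^2(k)=k$ and $E_{Z(A_t)}(k^{-1}q)=1$. For $a\in A$ put $$a^{*_k}=ka^*k^{-1},\qquad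 \Delta_k(a)=\Delta(a)(1\otimes k^{-1}),\qquad \kappa_k(a)=k\kappa(a)k^{-1},\qquad \epsilon_k(a)=\epsilon(ak),$$ and let $A_k$ be the algebra $A$ with the involution $*_k$. Then $(A_k,\Delta_k,\kappa_k,\epsilon_k)$ is a $C^*$-quantum groupoid, it has the same target and the same source Cartan subalgebra as $(A,\Delta,\kappa,\epsilon)$, and its canonical element is $k^{-1}q$: this is the one and only element having properties 1–4 relative to $(A_k,\Delta_k,\kappa_k,\epsilon_k)$. -/

import Mathlib

open scoped TensorProduct ComplexOrder ComplexConjugate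

/-- The data `(*, Δ, κ, ε)` on a complex unital algebra `A`: a conjugate-linear map `inv` (the
involution), a linear map `comul : A → A ⊗ A` (the coproduct), a linear bijection `antipode : A → A`
and a linear form `counit`. No law is imposed here, see `IsCStarQuantumGroupoid`; the antipode of a
`C*`-quantum groupoid is bijective because of `(κ ∘ *)² = id`. -/
structure QuantumGroupoidData (A : Type*) [Ring A] [Algebra ℂ A] where
  inv : A →ₗ⋆[ℂ] A
  comul : A →ₗ[ℂ] A ⊗[ℂ] A
  antipode : A ≃ₗ[ℂ] A
  counit : A →ₗ[ℂ] ℂ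

namespace QuantumGroupoidData

variable {A : Type*} [Ring A] [Algebra ℂ A]

/-- `(A, Δ, κ, ε)`, with involution `*`, is a `C*`-quantum groupoid (weak Hopf `C*`-algebra). -/
structure IsCStarQuantumGroupoid (G : QuantumGroupoidData A) : Prop where
  finite : Module.Finite ℂ A
  inv_inv : ∀ a, G.inv (G.inv a) = a
  inv_mul : ∀ a b, G.inv (a * b) = G.inv b * G.inv a
  /-- `(A, *)` is a `C*`-algebra: it carries an algebra norm with `‖a* a‖ = ‖a‖²` (completeness is
  automatic in finite dimension, and there is at most one such norm). -/
  cstar : ∃ ν : AlgebraNorm ℂ A, ∀ a, ν (G.inv a * a) = ν a ^ 2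
  /-- `Δ` is a homomorphism of `*`-algebras, not necessarily unital. -/
  comul_mul : ∀ a b, G.comul (a * b) = G.comul a * G.comul b
  comul_inv : ∀ a, G.comul (G.inv a) = TensorProduct.map G.inv G.inv (G.comul a)
  /-- `(Δ ⊗ i) Δ = (i ⊗ Δ) Δ`. -/
  coassoc : ∀ a,
    TensorProduct.assoc ℂ A A A
        (TensorProduct.map G.comul (LinearMap.id : A →ₗ[ℂ] A) (G.comul a)) =
      TensorProduct.map (LinearMap.id : A →ₗ[ℂ] A) G.comul (G.comul a)
  /-- `(κ ∘ *)² = i`. -/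
  antipode_inv : ∀ a, G.antipode (G.inv (G.antipode (G.inv a))) = a
  antipode_mul : ∀ a b, G.antipode (a * b) = G.antipode b * G.antipode a
  /-- `(κ ⊗ κ) Δ = ς Δ κ`, with `ς` the flip. -/
  antipode_comul : ∀ a,
    TensorProduct.map G.antipode.toLinearMap G.antipode.toLinearMap (G.comul a) =
      TensorProduct.comm ℂ A A (G.comul (G.antipode a))
  /-- `(m(κ ⊗ i) ⊗ i)(Δ ⊗ i) Δ(x) = (1 ⊗ x) Δ(1)`. -/
  antipode_comul_comul : ∀ x,
    TensorProduct.map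
        (LinearMap.mul' ℂ A ∘ₗ
          TensorProduct.map G.antipode.toLinearMap (LinearMap.id : A →ₗ[ℂ] A))
        (LinearMap.id : A →ₗ[ℂ] A)
        (TensorProduct.map G.comul (LinearMap.id : A →ₗ[ℂ] A) (G.comul x)) =
      ((1 : A) ⊗ₜ[ℂ] x) * G.comul 1
  /-- `ε` is a positive linear form. -/
  counit_nonneg : ∀ a, 0 ≤ G.counit (G.inv a * a)
  /-- `(ε ⊗ i) Δ = i`. -/
  counit_left : ∀ a,
    TensorProduct.lid ℂ A
      (TensorProduct.map G.counit (LinearMap.id : A →ₗ[ℂ] A) (G.comul a)) = a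
  /-- `(i ⊗ ε) Δ = i`. -/
  counit_right : ∀ a,
    TensorProduct.rid ℂ A
      (TensorProduct.map (LinearMap.id : A →ₗ[ℂ] A) G.counit (G.comul a)) = a
  /-- `(ε ⊗ ε)((x ⊗ 1) Δ(1) (1 ⊗ y)) = ε(xy)`. -/
  counit_mul : ∀ x y,
    TensorProduct.lid ℂ ℂ
        (TensorProduct.map G.counit G.counit
          ((x ⊗ₜ[ℂ] (1 : A)) * G.comul 1 * ((1 : A) ⊗ₜ[ℂ] y))) =
      G.counit (x * y)

/-- The target Cartan subalgebra
`A_t = {x | Δ(x) = Δ(1)(x ⊗ 1) = (x ⊗ 1)Δ(1)}`, as a subset of `A`. -/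
def targetCartan (G : QuantumGroupoidData A) : Set A :=
  {x | G.comul x = G.comul 1 * (x ⊗ₜ[ℂ] (1 : A)) ∧ G.comul x = (x ⊗ₜ[ℂ] (1 : A)) * G.comul 1}

/-- The source Cartan subalgebra
`A_s = {x | Δ(x) = Δ(1)(1 ⊗ x) = (1 ⊗ x)Δ(1)}`, as a subset of `A`. -/
def sourceCartan (G : QuantumGroupoidData A) : Set A :=
  {x | G.comul x = G.comul 1 * ((1 : A) ⊗ₜ[ℂ] x) ∧ G.comul x = ((1 : A) ⊗ₜ[ℂ] x) * G.comul 1}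

/-- Positivity in the `C*`-algebra `(A, *)`. -/
def IsPositive (G : QuantumGroupoidData A) (a : A) : Prop :=
  ∃ b, a = G.inv b * b

end QuantumGroupoidData

/-- A family of matrix units `e^γ_{i,j}` (`1 ≤ i, j ≤ n_γ`) of a unital subalgebra `N` of `A`:
a linear basis of `N` that multiplies like the elementary matrices of `⨁_γ M_{n_γ}(ℂ)`. It is not
required to be compatible with an involution. -/
structure MatrixUnits {A : Type*} [Ring A] [Algebra ℂ A] (N : Set A) where
  blocks : ℕ
  size : Fin blocks → ℕ
  size_pos : ∀ γ, 0 < size γ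
  e : (γ : Fin blocks) → Fin (size γ) → Fin (size γ) → A
  mul_same : ∀ γ i j k l, e γ i j * e γ k l = if j = k then e γ i l else 0
  mul_of_ne : ∀ γ δ, γ ≠ δ → ∀ i j k l, e γ i j * e δ k l = 0
  sum_diag : ∑ γ, ∑ i, e γ i i = 1
  linearIndependent : LinearIndependent ℂ
    (fun p : (γ : Fin blocks) × (Fin (size γ) × Fin (size γ)) => e p.1 p.2.1 p.2.2)
  span_eq : (Submodule.span ℂ (Set.range
    (fun p : (γ : Fin blocks) × (Fin (size γ) × Fin (size γ)) => e p.1 p.2.1 p.2.2)) : Set A) = N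

/-- The canonical (trace preserving) conditional expectation of `N` onto its center, evaluated at
`x ∈ N`: `E_{Z(N)}(x) = ∑_{γ,i,j} (1/n_γ) e^γ_{i,j} x e^γ_{j,i}`. It does not depend on the choice
of the matrix units. -/
noncomputable def MatrixUnits.centerExpectation {A : Type*} [Ring A] [Algebra ℂ A] {N : Set A}
    (u : MatrixUnits N) (x : A) : A :=
  ∑ γ, ∑ i, ∑ j, (1 / (u.size γ : ℂ)) • (u.e γ i j * x * u.e γ j i)

namespace QuantumGroupoidData

variable {A : Type*} [Ring A] [Algebra ℂ A]

/-- `Δ(1) = ∑_{γ,i,j} (1/n_γ) κ⁻¹(e^γ_{i,j} q) ⊗ e^γ_{j,i}` for the matrix units `u` of `A_t`. -/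
def ComulOneFormula (G : QuantumGroupoidData A) (u : MatrixUnits G.targetCartan) (q : A) : Prop :=
  G.comul 1 = ∑ γ, ∑ i, ∑ j,
    (1 / (u.size γ : ℂ)) • (G.antipode.symm (u.e γ i j * q) ⊗ₜ[ℂ] u.e γ j i)

/-- `q` has all the properties of the canonical element of `(A, Δ, κ, ε)`. -/
structure IsCanonicalElement (G : QuantumGroupoidData A) (q : A) : Prop where
  mem : q ∈ G.targetCartan
  isUnit : IsUnit q
  comul_one : ∀ u : MatrixUnits G.targetCartan, G.ComulOneFormula u q
  antipode_sq_self : G.antipode (G.antipode q) = q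
  centerExpectation_eq : ∀ u : MatrixUnits G.targetCartan, u.centerExpectation q = 1
  /-- `κ²(x) = q⁻¹ κ(q) x q κ(q⁻¹)` on the algebra generated by `A_t` and `A_s`. Both are closed
  under the involution, hence so is the algebra that they generate. -/
  antipode_sq : ∀ x ∈ Algebra.adjoin ℂ (G.targetCartan ∪ G.sourceCartan),
    G.antipode (G.antipode x) =
      Ring.inverse q * G.antipode q * x * q * G.antipode (Ring.inverse q)
  positive : G.IsPositive q

/-- The deformed data: `a^{*_k} = k a* k⁻¹`, `Δ_k(a) = Δ(a)(1 ⊗ k⁻¹)`, `κ_k(a) = k κ(a) k⁻¹`,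
`ε_k(a) = ε(ak)`. -/
noncomputable def deform (G : QuantumGroupoidData A) (k : Aˣ) : QuantumGroupoidData A where
  inv :=
    { toFun := fun a => (k : A) * G.inv a * ((k⁻¹ : Aˣ) : A)
      map_add' := fun a b => by rw [map_add, mul_add, add_mul]
      map_smul' := fun c a => by rw [LinearMap.map_smulₛₗ, mul_smul_comm, smul_mul_assoc] }
  comul :=
    { toFun := fun a => G.comul a * ((1 : A) ⊗ₜ[ℂ] ((k⁻¹ : Aˣ) : A))
      map_add' := fun a b => by rw [map_add, add_mul]
      map_smul' := fun c a => by rw [map_smul, smul_mul_assoc, RingHom.id_apply] }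
  antipode :=
    { toFun := fun a => (k : A) * G.antipode a * ((k⁻¹ : Aˣ) : A)
      map_add' := fun a b => by rw [map_add, mul_add, add_mul]
      map_smul' := fun c a => by
        rw [map_smul, mul_smul_comm, smul_mul_assoc, RingHom.id_apply]
      invFun := fun a => G.antipode.symm (((k⁻¹ : Aˣ) : A) * a * (k : A))
      left_inv := fun a => by simp [mul_assoc]
      right_inv := fun a => by simp [mul_assoc] }
  counit :=
    { toFun := fun a => G.counit (a * (k : A))
      map_add' := fun a b => by rw [add_mul, map_add]
      map_smul' := fun c a => by rw [smul_mul_assoc, map_smul, RingHom.id_apply] }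

end QuantumGroupoidData

/-! Everything follows from Property 1, read as `Δ(1) = (κ⁻¹ ⊗ i)(C (q ⊗ 1))`, where `C` is the
symmetric separability idempotent of `A_t` (`casimir`). Since `(x ⊗ 1) C = C (1 ⊗ x)` and `C (x ⊗ 1)
= (1 ⊗ x) C` for `x` in `A_t`, elements of `A_t` can be moved between the legs of `Δ(1)`, and a
middle factor is absorbed: `Δ(1)(1 ⊗ x)Δ(1) = Δ(1)(1 ⊗ E(qx))`. With `E(q k⁻¹) = 1` this makes `Δ_k`
multiplicative; together with `κ(1₁) y 1₂ = E(qy)` it gives the antipode axiom. The other axioms use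
only that `k` is positive and lies in `A_t`, and the leg rules.

Property 1 also implies the other properties of a canonical element
(`ComulOneFormula.isCanonicalElement`). Applying `i ⊗ ε` to `Δ(1)` gives `p q = 1`, where `p` is the
density of `ε` on `A_t` for the regular trace. So `q` is invertible and determined by `p`; it is
positive because a positive functional has a positive density. Computing `(1 ⊗ x)Δ(1)` in two ways
gives `κ²(x) = q⁻¹ x q` on `A_t`, and applying `κ` gives the rule on `A_s`.

Hence it is enough to check Property 1 for `k⁻¹ q` in the deformed structure. The hypothesis `κ²(k)
= k` enters as the commutation of `k` with `q`. -/

/-! ### Positive functionals and the regular trace of a finite-dimensional C*-algebra. -/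

section PositiveDensity

variable {B : Type*} [CStarAlgebra B]

/-- The positive elements span `B`, and `φ` is real on them. -/
lemma map_star_of_map_nonneg [PartialOrder B] [StarOrderedRing B] (φ : B →ₗ[ℂ] ℂ)
    (hφ : ∀ a, 0 ≤ a → 0 ≤ φ a) (a : B) : φ (star a) = star (φ a) := by
  have ha : a ∈ Submodule.span ℂ {a : B | 0 ≤ a} := by
    rw [CStarAlgebra.span_nonneg]; trivial
  induction ha using Submodule.span_induction with
  | mem x hx =>
    have hx' : star x = x := IsSelfAdjoint.of_nonneg hx
    rw [hx']
    exact (Complex.conj_eq_iff_im.2 (Complex.nonneg_iff.1 (hφ x hx)).2.symm).symm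
  | zero => simp
  | add x y _ _ hx hy => simp only [star_add, map_add, hx, hy]
  | smul c x _ hx => simp only [star_smul, map_smul, hx, smul_eq_mul, star_mul']

variable [FiniteDimensional ℂ B]

lemma nonneg_of_isRoot_charpoly_lmul [PartialOrder B] [StarOrderedRing B] {a : B} (ha : 0 ≤ a)
    {z : ℂ} (hz : z ∈ (Algebra.lmul ℂ B a).charpoly.roots) : 0 ≤ z := by
  have h1 : z ∈ spectrum ℂ (Algebra.lmul ℂ B a) :=
    (Module.End.mem_spectrum_iff_isRoot_charpoly _ _).2 (Polynomial.isRoot_of_mem_roots hz)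
  exact spectrum_nonneg_of_nonneg ha (AlgHom.spectrum_apply_subset (Algebra.lmul ℂ B) a h1)

lemma trace_lmul_nonneg [PartialOrder B] [StarOrderedRing B] {a : B} (ha : 0 ≤ a) :
    0 ≤ LinearMap.trace ℂ B (Algebra.lmul ℂ B a) := by
  rw [Module.End.trace_eq_sum_roots_charpoly_of_splits (IsAlgClosed.splits _)]
  exact Multiset.sum_nonneg fun z hz => nonneg_of_isRoot_charpoly_lmul ha hz

lemma eq_zero_of_trace_lmul_eq_zero [PartialOrder B] [StarOrderedRing B] {a : B} (ha : 0 ≤ a)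
    (h : LinearMap.trace ℂ B (Algebra.lmul ℂ B a) = 0) : a = 0 := by
  rw [Module.End.trace_eq_sum_roots_charpoly_of_splits (IsAlgClosed.splits _)] at h
  have hroots : ∀ z ∈ (Algebra.lmul ℂ B a).charpoly.roots, z = 0 :=
    fun z hz => le_antisymm (h ▸ Multiset.single_le_sum
      (fun w hw => nonneg_of_isRoot_charpoly_lmul ha hw) z hz)
      (nonneg_of_isRoot_charpoly_lmul ha hz)
  have hspec : spectrum ℂ (Algebra.lmul ℂ B a) ⊆ {0} := fun z hz =>
    hroots z ((Polynomial.mem_roots (LinearMap.charpoly_monic _).ne_zero).2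
      ((Module.End.mem_spectrum_iff_isRoot_charpoly _ _).1 hz))
  have hspec' : spectrum ℂ a ⊆ {0} := by
    intro z hz
    refine hspec ?_
    contrapose! hz
    -- If left multiplication by `z - a` is bijective, then `z - a` has a right inverse, hence is a
    -- unit by finite dimension.
    rw [spectrum.notMem_iff] at hz ⊢
    have hz' : IsUnit (Algebra.lmul ℂ B (algebraMap ℂ B z - a)) := by
      rw [map_sub, AlgHom.commutes]; exact hz
    obtain ⟨b, hb⟩ := ((Module.End.isUnit_iff _).1 hz').surjective 1
    have : IsNoetherianRing B := IsNoetherianRing.of_finite ℂ B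
    exact IsUnit.of_mul_eq_one b hb
  have : IsSelfAdjoint a := .of_nonneg ha
  exact CFC.eq_zero_of_spectrum_subset_zero (R := ℂ) a hspec'

lemma trace_lmul_star [PartialOrder B] [StarOrderedRing B] (a : B) :
    LinearMap.trace ℂ B (Algebra.lmul ℂ B (star a)) =
      star (LinearMap.trace ℂ B (Algebra.lmul ℂ B a)) :=
  map_star_of_map_nonneg (LinearMap.trace ℂ B ∘ₗ (Algebra.lmul ℂ B).toLinearMap)
    (fun _ ha => trace_lmul_nonneg ha) a

/-- The density of a positive functional with respect to the trace of the regular representation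
is positive. -/
lemma exists_star_mul_self_of_trace_lmul (φ : B →ₗ[ℂ] ℂ) (hφ : ∀ a, 0 ≤ φ (star a * a)) (p : B)
    (hp : ∀ x, φ x = LinearMap.trace ℂ B (Algebra.lmul ℂ B (p * x))) :
    ∃ c, p = star c * c := by
  let _ := CStarAlgebra.spectralOrder B
  let _ := CStarAlgebra.spectralOrderedRing B
  have hpos : ∀ a : B, 0 ≤ a → 0 ≤ φ a := by
    intro a ha
    obtain ⟨b, rfl⟩ := CStarAlgebra.nonneg_iff_eq_star_mul_self.1 ha
    exact hφ b
  have hnondeg : ∀ y : B, (∀ x, LinearMap.trace ℂ B (Algebra.lmul ℂ B (y * x)) = 0) → y = 0 := by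
    intro y hy
    exact (CStarRing.mul_star_self_eq_zero_iff _).1
      (eq_zero_of_trace_lmul_eq_zero (mul_star_self_nonneg y) (hy _))
  have hp_self : IsSelfAdjoint p := by
    refine sub_eq_zero.1 (hnondeg _ fun x => ?_)
    have h1 : LinearMap.trace ℂ B (Algebra.lmul ℂ B (star p * x)) = φ x := by
      rw [← star_star x, map_star_of_map_nonneg φ hpos, hp, ← trace_lmul_star, star_mul, star_star,
        map_mul (Algebra.lmul ℂ B), map_mul (Algebra.lmul ℂ B), LinearMap.trace_mul_comm]
    rw [sub_mul, map_sub, map_sub, h1, hp, sub_self]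
  -- Test `φ` on `p⁻`: positivity gives `φ(p⁻) ≥ 0`, while `p p⁻ = -(p⁻)²` makes it minus the trace
  -- of a positive element. Faithfulness of the trace forces `p⁻ = 0`.
  have hneg : p⁻ = 0 := by
    have h1 : p * p⁻ = -(p⁻ * p⁻) := by
      nth_rewrite 1 [← CFC.posPart_sub_negPart p hp_self]
      rw [sub_mul, CFC.posPart_mul_negPart, zero_sub]
    have h2 := hpos _ (CFC.negPart_nonneg p)
    rw [hp, h1, map_neg, map_neg, Left.nonneg_neg_iff] at h2
    have h3 : star p⁻ = p⁻ := IsSelfAdjoint.of_nonneg (CFC.negPart_nonneg p)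
    have h4 : star p⁻ * p⁻ = 0 := by
      have h5 := star_mul_self_nonneg p⁻
      exact eq_zero_of_trace_lmul_eq_zero h5
        (le_antisymm (by rwa [h3]) (trace_lmul_nonneg h5))
    exact (CStarRing.star_mul_self_eq_zero_iff _).1 h4
  exact CStarAlgebra.nonneg_iff_eq_star_mul_self.1 ((CFC.negPart_eq_zero_iff p hp_self).1 hneg)

end PositiveDensity

/-- Transports the density result to an algebra whose involution and C*-norm are given as bare data,
as they are for `A_t`. -/
lemma exists_inv_mul_self_of_trace_lmul {B : Type*} [Ring B] [Algebra ℂ B] [Module.Finite ℂ B]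
    (inv : B →ₗ⋆[ℂ] B) (inv_inv : ∀ a, inv (inv a) = a)
    (inv_mul : ∀ a b, inv (a * b) = inv b * inv a)
    (ν : AlgebraNorm ℂ B) (hν : ∀ a, ν (inv a * a) = ν a ^ 2)
    (φ : B →ₗ[ℂ] ℂ) (hφ : ∀ a, 0 ≤ φ (inv a * a)) (p : B)
    (hp : ∀ x, φ x = LinearMap.trace ℂ B (Algebra.lmul ℂ B (p * x))) :
    ∃ c, p = inv c * c := by
  let _ : NormedRing B := ν.toRingNorm.toNormedRing
  let _ : NormedAlgebra ℂ B := { (inferInstance : Algebra ℂ B) with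
    norm_smul_le := fun c x => (map_smul_eq_mul ν c x).le }
  let _ : StarRing B :=
    { star := inv, star_involutive := inv_inv, star_mul := inv_mul, star_add := map_add inv }
  let _ : CStarAlgebra B :=
    { (inferInstance : NormedRing B), (inferInstance : StarRing B),
      (inferInstance : NormedAlgebra ℂ B) with
      complete := (FiniteDimensional.complete ℂ B).complete
      norm_mul_self_le := fun x => by
        rw [← sq]; exact (hν x).ge
      star_smul := fun c x => LinearMap.map_smulₛₗ inv c x }
  exact exists_star_mul_self_of_trace_lmul φ hφ p hp

/-! ### Algebra in `A ⊗ A`. -/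

section TensorLemmas

variable {A : Type*} [Ring A] [Algebra ℂ A]

/-- Semilinear, so that it serves both the involution and the antipode. -/
lemma TensorProduct.map_antimul {σ : ℂ →+* ℂ} {f g : A →ₛₗ[σ] A}
    (hf : ∀ a b, f (a * b) = f b * f a) (hg : ∀ a b, g (a * b) = g b * g a) (x y : A ⊗[ℂ] A) :
    TensorProduct.map f g (x * y) = TensorProduct.map f g y * TensorProduct.map f g x := by
  induction x with
  | zero => simp
  | add x x' hx hx' => simp only [add_mul, mul_add, map_add, hx, hx']
  | tmul a b =>
    induction y with
    | zero => simp
    | add y y' hy hy' => simp only [add_mul, mul_add, map_add, hy, hy']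
    | tmul c d => simp [hf, hg]

lemma TensorProduct.comm_mul (x y : A ⊗[ℂ] A) :
    TensorProduct.comm ℂ A A (x * y) = TensorProduct.comm ℂ A A x * TensorProduct.comm ℂ A A y :=
  map_mul (Algebra.TensorProduct.comm ℂ A A) x y

/-- A left slice map is linear over the second tensor factor. -/
lemma TensorProduct.lid_map_mul_one_tmul (φ : A →ₗ[ℂ] ℂ) (z : A ⊗[ℂ] A) (x : A) :
    TensorProduct.lid ℂ A (TensorProduct.map φ LinearMap.id (z * ((1 : A) ⊗ₜ[ℂ] x))) =
      TensorProduct.lid ℂ A (TensorProduct.map φ LinearMap.id z) * x := by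
  induction z with
  | zero => simp
  | add y y' hy hy' => simp only [add_mul, map_add, hy, hy']
  | tmul c d => simp

/-- A right slice map is linear over the first tensor factor. -/
lemma TensorProduct.rid_map_tmul_one_mul (φ : A →ₗ[ℂ] ℂ) (z : A ⊗[ℂ] A) (x : A) :
    TensorProduct.rid ℂ A (TensorProduct.map LinearMap.id φ ((x ⊗ₜ[ℂ] (1 : A)) * z)) =
      x * TensorProduct.rid ℂ A (TensorProduct.map LinearMap.id φ z) := by
  induction z with
  | zero => simp
  | add y y' hy hy' => simp only [mul_add, map_add, hy, hy']
  | tmul c d => simp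

end TensorLemmas

/-! ### The separability idempotent of a multi-matrix algebra. -/

namespace MatrixUnits

variable {A : Type*} [Ring A] [Algebra ℂ A] {N : Set A}

/-- The symmetric separability idempotent `∑ (1/n_γ) e^γ_{i,j} ⊗ e^γ_{j,i}`. -/
noncomputable def casimir (u : MatrixUnits N) : A ⊗[ℂ] A :=
  ∑ γ, ∑ i, ∑ j, (1 / (u.size γ : ℂ)) • (u.e γ i j ⊗ₜ[ℂ] u.e γ j i)

lemma e_mem (u : MatrixUnits N) (γ : Fin u.blocks) (i j : Fin (u.size γ)) : u.e γ i j ∈ N := by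
  have h : u.e γ i j ∈ (Submodule.span ℂ (Set.range
    (fun p : (γ : Fin u.blocks) × (Fin (u.size γ) × Fin (u.size γ)) => u.e p.1 p.2.1 p.2.2))) :=
    Submodule.subset_span ⟨⟨γ, i, j⟩, rfl⟩
  exact u.span_eq.subset h

lemma size_ne_zero (u : MatrixUnits N) (γ : Fin u.blocks) : (u.size γ : ℂ) ≠ 0 :=
  Nat.cast_ne_zero.2 (u.size_pos γ).ne'

lemma induction (u : MatrixUnits N) {P : A → Prop} (he : ∀ γ i j, P (u.e γ i j)) (h0 : P 0)
    (hadd : ∀ x y, P x → P y → P (x + y)) (hsmul : ∀ (c : ℂ) x, P x → P (c • x))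
    {x : A} (hx : x ∈ N) : P x := by
  rw [← u.span_eq] at hx
  induction (hx : x ∈ Submodule.span ℂ _) using Submodule.span_induction with
  | mem x hx => obtain ⟨p, rfl⟩ := hx; exact he _ _ _
  | zero => exact h0
  | add x y _ _ hx hy => exact hadd x y hx hy
  | smul c x _ hx => exact hsmul c x hx

/-- For `x = e^δ_{k,l}` both sides are `(1/n_δ) ∑_j e^δ_{k,j} ⊗ e^δ_{j,l}`. -/
lemma tmul_one_mul_casimir (u : MatrixUnits N) {x : A} (hx : x ∈ N) :
    (x ⊗ₜ[ℂ] (1 : A)) * u.casimir = u.casimir * ((1 : A) ⊗ₜ[ℂ] x) := by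
  refine u.induction (P := fun x => (x ⊗ₜ[ℂ] (1 : A)) * u.casimir =
    u.casimir * ((1 : A) ⊗ₜ[ℂ] x)) ?_ ?_ ?_ ?_ hx
  · intro δ k l
    simp only [casimir, Finset.mul_sum, Finset.sum_mul, mul_smul_comm, smul_mul_assoc,
      Algebra.TensorProduct.tmul_mul_tmul, one_mul, mul_one]
    rw [Finset.sum_eq_single δ, Finset.sum_eq_single δ]
    · simp [u.mul_same, TensorProduct.ite_tmul, TensorProduct.tmul_ite]
    · intro γ _ h
      simp [u.mul_of_ne γ δ h]
    · simp
    · intro γ _ h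
      simp [u.mul_of_ne δ γ h.symm]
    · simp
  · simp
  · intro x y h1 h2
    simp only [TensorProduct.add_tmul, TensorProduct.tmul_add, add_mul, mul_add, h1, h2]
  · intro c x h
    simp only [TensorProduct.tmul_smul, ← TensorProduct.smul_tmul', smul_mul_assoc,
      mul_smul_comm, h]

lemma casimir_mul_tmul_one (u : MatrixUnits N) {x : A} (hx : x ∈ N) :
    u.casimir * (x ⊗ₜ[ℂ] (1 : A)) = ((1 : A) ⊗ₜ[ℂ] x) * u.casimir := by
  have hcomm : TensorProduct.comm ℂ A A u.casimir = u.casimir := by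
    simp only [casimir, map_sum, map_smul, TensorProduct.comm_tmul]
    exact Finset.sum_congr rfl fun γ _ => Finset.sum_comm
  have h := congrArg (TensorProduct.comm ℂ A A) (u.tmul_one_mul_casimir hx)
  simpa only [TensorProduct.comm_mul, hcomm, TensorProduct.comm_tmul] using h.symm

lemma sum_e_mul_e (u : MatrixUnits N) :
    ∑ γ, ∑ i, ∑ j, (1 / (u.size γ : ℂ)) • (u.e γ i j * u.e γ j i) = 1 := by
  rw [← u.sum_diag]
  refine Finset.sum_congr rfl fun γ _ => Finset.sum_congr rfl fun i _ => ?_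
  simp only [u.mul_same, if_true, Finset.sum_const, Finset.card_univ, Fintype.card_fin]
  rw [← Nat.cast_smul_eq_nsmul ℂ, smul_smul, mul_one_div_cancel (u.size_ne_zero γ), one_smul]

lemma sum_sum_sum_comm {M ι : Type*} [AddCommMonoid M] [Fintype ι] (u : MatrixUnits N)
    (F : ι → (γ : Fin u.blocks) → Fin (u.size γ) → Fin (u.size γ) → M) :
    ∑ x, ∑ γ, ∑ i, ∑ j, F x γ i j = ∑ γ, ∑ i, ∑ j, ∑ x, F x γ i j := by
  rw [Finset.sum_comm]
  refine Finset.sum_congr rfl fun γ _ => ?_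
  rw [Finset.sum_comm]
  exact Finset.sum_congr rfl fun i _ => Finset.sum_comm

/-- The separability idempotent does not depend on the matrix units. -/
lemma casimir_eq (u v : MatrixUnits N) : u.casimir = v.casimir := by
  -- With the second leg multiplied in the opposite order, the product of the two idempotents equals
  -- the `v` one by `h1` and the `u` one by `h2`.
  have h1 : ∑ γ, ∑ i, ∑ j, (1 / (u.size γ : ℂ)) •
      ((u.e γ i j ⊗ₜ[ℂ] (1 : A)) * v.casimir * ((1 : A) ⊗ₜ[ℂ] u.e γ j i)) = v.casimir := by
    have h : v.casimir * ((1 : A) ⊗ₜ[ℂ] (∑ γ, ∑ i, ∑ j,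
        (1 / (u.size γ : ℂ)) • (u.e γ i j * u.e γ j i))) = v.casimir := by
      rw [u.sum_e_mul_e, ← Algebra.TensorProduct.one_def, mul_one]
    conv_rhs => rw [← h]
    simp only [TensorProduct.tmul_sum, TensorProduct.tmul_smul, Finset.mul_sum, mul_smul_comm,
      v.tmul_one_mul_casimir (u.e_mem _ _ _), mul_assoc, Algebra.TensorProduct.tmul_mul_tmul,
      one_mul]
  have h2 : ∑ γ, ∑ i, ∑ j, (1 / (v.size γ : ℂ)) •
      (((1 : A) ⊗ₜ[ℂ] v.e γ j i) * u.casimir * (v.e γ i j ⊗ₜ[ℂ] (1 : A))) = u.casimir := by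
    have h : ((1 : A) ⊗ₜ[ℂ] (∑ γ, ∑ i, ∑ j,
        (1 / (v.size γ : ℂ)) • (v.e γ i j * v.e γ j i))) * u.casimir = u.casimir := by
      rw [v.sum_e_mul_e, ← Algebra.TensorProduct.one_def, one_mul]
    conv_rhs => rw [← h]
    simp only [TensorProduct.tmul_sum, TensorProduct.tmul_smul, Finset.sum_mul, smul_mul_assoc,
      mul_assoc, u.casimir_mul_tmul_one (v.e_mem _ _ _)]
    simp only [← mul_assoc, Algebra.TensorProduct.tmul_mul_tmul, one_mul]
    exact Finset.sum_congr rfl fun γ _ => Finset.sum_comm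
  rw [← h1, ← h2]
  simp only [casimir, Finset.mul_sum, Finset.sum_mul, mul_smul_comm, smul_mul_assoc,
    Algebra.TensorProduct.tmul_mul_tmul, one_mul, mul_one, Finset.smul_sum]
  simp only [u.sum_sum_sum_comm]
  refine Finset.sum_congr rfl fun γ _ => Finset.sum_congr rfl fun i _ =>
    Finset.sum_congr rfl fun j _ => Finset.sum_congr rfl fun δ _ =>
    Finset.sum_congr rfl fun k _ => Finset.sum_congr rfl fun l _ => ?_
  rw [smul_comm]

end MatrixUnits

/-! ### The regular trace on matrix units. -/

section RegularTrace

variable {A : Type*} [Ring A] [Algebra ℂ A] {S : Subalgebra ℂ A}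

/-- The matrix units as a basis of the subalgebra. -/
noncomputable def MatrixUnits.basis (u : MatrixUnits (S : Set A)) :
    Module.Basis ((γ : Fin u.blocks) × (Fin (u.size γ) × Fin (u.size γ))) ℂ S :=
  Module.Basis.mk (v := fun p => (⟨u.e p.1 p.2.1 p.2.2, u.e_mem _ _ _⟩ : S))
    (LinearIndependent.of_comp S.val.toLinearMap u.linearIndependent)
    (by
      rintro ⟨x, hx⟩ -
      obtain ⟨_, h⟩ := u.induction (P := fun x => ∃ hx : x ∈ S, (⟨x, hx⟩ : S) ∈
        Submodule.span ℂ (Set.range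
          fun p : (γ : Fin u.blocks) × (Fin (u.size γ) × Fin (u.size γ)) =>
            (⟨u.e p.1 p.2.1 p.2.2, u.e_mem _ _ _⟩ : S)))
        (fun γ i j => ⟨u.e_mem γ i j, Submodule.subset_span ⟨⟨γ, i, j⟩, rfl⟩⟩)
        ⟨S.zero_mem, Submodule.zero_mem _⟩
        (fun x y ⟨hx, hx'⟩ ⟨hy, hy'⟩ => ⟨S.add_mem hx hy, Submodule.add_mem _ hx' hy'⟩)
        (fun c x ⟨hx, hx'⟩ => ⟨S.smul_mem hx c, Submodule.smul_mem _ c hx'⟩) hx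
      exact h)

lemma MatrixUnits.basis_apply (u : MatrixUnits (S : Set A))
    (p : (γ : Fin u.blocks) × (Fin (u.size γ) × Fin (u.size γ))) :
    (u.basis p : A) = u.e p.1 p.2.1 p.2.2 := by
  simp [MatrixUnits.basis]

/-- Left multiplication by `e_{i,j}` sends `e_{j,l}` to `e_{i,l}` and kills the other basis vectors.
A diagonal entry thus needs `i = j`, and then each of the `n_γ` values of `l` contributes 1. -/
lemma MatrixUnits.trace_lmul (u : MatrixUnits (S : Set A)) (γ : Fin u.blocks)
    (i j : Fin (u.size γ)) :
    LinearMap.trace ℂ S (Algebra.lmul ℂ S (u.basis ⟨γ, i, j⟩)) =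
      if i = j then (u.size γ : ℂ) else 0 := by
  rw [LinearMap.trace_eq_matrix_trace ℂ u.basis, Matrix.trace, Fintype.sum_sigma,
    Finset.sum_eq_single γ]
  · have hmul : ∀ k l : Fin (u.size γ), u.basis ⟨γ, i, j⟩ * u.basis ⟨γ, k, l⟩ =
        if j = k then u.basis ⟨γ, i, l⟩ else 0 := by
      intro k l
      apply Subtype.ext
      split_ifs with hjk <;> simp [MatrixUnits.basis_apply, u.mul_same, hjk]
    simp only [Fintype.sum_prod_type, Matrix.diag, LinearMap.toMatrix_apply,
      Algebra.coe_lmul_eq_mul, LinearMap.mul_apply', hmul]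
    rw [Finset.sum_eq_single j]
    · split_ifs with h1 h2 h2
      · simp [h2]
      · simp [h2]
      · exact absurd rfl h1
      · exact absurd rfl h1
    · intro k _ hk
      simp [hk.symm]
    · simp
  · intro δ _ hδ
    have hmul : ∀ k l : Fin (u.size δ), u.basis ⟨γ, i, j⟩ * u.basis ⟨δ, k, l⟩ = 0 := by
      intro k l
      apply Subtype.ext
      simp [MatrixUnits.basis_apply, u.mul_of_ne γ δ hδ.symm]
    simp [Matrix.diag, LinearMap.toMatrix_apply, hmul]
  · simp

end RegularTrace

/-! ### Cartan subalgebras and the antipode. -/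

namespace QuantumGroupoidData

variable {A : Type*} [Ring A] [Algebra ℂ A] {G : QuantumGroupoidData A}

namespace IsCStarQuantumGroupoid

lemma inv_one (hG : G.IsCStarQuantumGroupoid) : G.inv 1 = 1 := by
  have h := hG.inv_mul (G.inv 1) 1
  rwa [mul_one, hG.inv_inv, mul_one, eq_comm] at h

lemma antipode_one (hG : G.IsCStarQuantumGroupoid) : G.antipode 1 = 1 := by
  have h := hG.antipode_mul (G.antipode.symm 1) 1
  rwa [mul_one, G.antipode.apply_symm_apply, mul_one, eq_comm] at h

lemma antipode_symm_mul (hG : G.IsCStarQuantumGroupoid) (a b : A) :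
    G.antipode.symm (a * b) = G.antipode.symm b * G.antipode.symm a := by
  apply G.antipode.injective
  simp [hG.antipode_mul]

lemma antipode_symm_one (hG : G.IsCStarQuantumGroupoid) : G.antipode.symm 1 = 1 := by
  rw [LinearEquiv.symm_apply_eq, hG.antipode_one]

lemma comul_one_mul_comul (hG : G.IsCStarQuantumGroupoid) (a : A) :
    G.comul 1 * G.comul a = G.comul a := by
  rw [← hG.comul_mul, one_mul]

lemma comul_mul_comul_one (hG : G.IsCStarQuantumGroupoid) (a : A) :
    G.comul a * G.comul 1 = G.comul a := by
  rw [← hG.comul_mul, mul_one]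

lemma comul_injective (hG : G.IsCStarQuantumGroupoid) : Function.Injective G.comul :=
  Function.LeftInverse.injective (g := fun z => TensorProduct.rid ℂ A
    (TensorProduct.map (LinearMap.id : A →ₗ[ℂ] A) G.counit z)) hG.counit_right

/-- The left leg of `Δ(1)` separates left multiplications. -/
lemma tmul_one_mul_comul_one_injective (hG : G.IsCStarQuantumGroupoid) {x y : A}
    (h : (x ⊗ₜ[ℂ] (1 : A)) * G.comul 1 = (y ⊗ₜ[ℂ] (1 : A)) * G.comul 1) : x = y := by
  have h' := congrArg (fun z => TensorProduct.rid ℂ A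
    (TensorProduct.map (LinearMap.id : A →ₗ[ℂ] A) G.counit z)) h
  simpa only [TensorProduct.rid_map_tmul_one_mul, hG.counit_right, mul_one] using h'

/-- The right leg of `Δ(1)` separates right multiplications. -/
lemma comul_one_mul_one_tmul_injective (hG : G.IsCStarQuantumGroupoid) {x y : A}
    (h : G.comul 1 * ((1 : A) ⊗ₜ[ℂ] x) = G.comul 1 * ((1 : A) ⊗ₜ[ℂ] y)) : x = y := by
  have h' := congrArg (fun z => TensorProduct.lid ℂ A
    (TensorProduct.map G.counit (LinearMap.id : A →ₗ[ℂ] A) z)) h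
  simpa only [TensorProduct.lid_map_mul_one_tmul, hG.counit_left, one_mul] using h'

/-- The target Cartan subalgebra as a subalgebra. -/
def targetSubalgebra (hG : G.IsCStarQuantumGroupoid) : Subalgebra ℂ A where
  carrier := G.targetCartan
  mul_mem' := by
    rintro x y ⟨hx, hx'⟩ ⟨hy, hy'⟩
    constructor
    · rw [hG.comul_mul, hy, ← mul_assoc, hG.comul_mul_comul_one, hx, mul_assoc,
        Algebra.TensorProduct.tmul_mul_tmul, one_mul]
    · rw [hG.comul_mul, hx', mul_assoc, hG.comul_one_mul_comul, hy', ← mul_assoc,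
        Algebra.TensorProduct.tmul_mul_tmul, one_mul]
  add_mem' := by
    rintro x y ⟨hx, hx'⟩ ⟨hy, hy'⟩
    constructor
    · rw [map_add, hx, hy, TensorProduct.add_tmul, mul_add]
    · rw [map_add, hx', hy', TensorProduct.add_tmul, add_mul]
  algebraMap_mem' := by
    intro c
    constructor <;> simp [Algebra.algebraMap_eq_smul_one, ← TensorProduct.smul_tmul',
      ← Algebra.TensorProduct.one_def]

lemma mem_targetSubalgebra (hG : G.IsCStarQuantumGroupoid) {x : A} :
    x ∈ hG.targetSubalgebra ↔ x ∈ G.targetCartan := Iff.rfl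

lemma mul_mem_target (hG : G.IsCStarQuantumGroupoid) {x y : A} (hx : x ∈ G.targetCartan)
    (hy : y ∈ G.targetCartan) : x * y ∈ G.targetCartan :=
  hG.targetSubalgebra.mul_mem hx hy

lemma comul_target_mul (hG : G.IsCStarQuantumGroupoid) {x : A} (a : A)
    (hx : x ∈ G.targetCartan) : G.comul (x * a) = (x ⊗ₜ[ℂ] (1 : A)) * G.comul a := by
  rw [hG.comul_mul, hx.2, mul_assoc, hG.comul_one_mul_comul]

lemma comul_mul_target (hG : G.IsCStarQuantumGroupoid) {x : A} (a : A)
    (hx : x ∈ G.targetCartan) : G.comul (a * x) = G.comul a * (x ⊗ₜ[ℂ] (1 : A)) := by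
  rw [hG.comul_mul, hx.1, ← mul_assoc, hG.comul_mul_comul_one]

lemma units_inv_mem_target (hG : G.IsCStarQuantumGroupoid) {k : Aˣ}
    (hk : (k : A) ∈ G.targetCartan) : ((k⁻¹ : Aˣ) : A) ∈ G.targetCartan := by
  have h1 : G.comul ((k⁻¹ : Aˣ) : A) * ((k : A) ⊗ₜ[ℂ] (1 : A)) = G.comul 1 := by
    rw [← hG.comul_mul_comul_one, mul_assoc, ← hk.1, ← hG.comul_mul, k.inv_mul]
  have h2 : ((k : A) ⊗ₜ[ℂ] (1 : A)) * G.comul ((k⁻¹ : Aˣ) : A) = G.comul 1 := by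
    rw [← hG.comul_one_mul_comul, ← mul_assoc, ← hk.2, ← hG.comul_mul, k.mul_inv]
  constructor
  · rw [← h1, mul_assoc, Algebra.TensorProduct.tmul_mul_tmul, k.mul_inv, one_mul,
      ← Algebra.TensorProduct.one_def, mul_one]
  · rw [← h2, ← mul_assoc, Algebra.TensorProduct.tmul_mul_tmul, k.inv_mul, one_mul,
      ← Algebra.TensorProduct.one_def, one_mul]

lemma inv_mem_target (hG : G.IsCStarQuantumGroupoid) {x : A} (hx : x ∈ G.targetCartan) :
    G.inv x ∈ G.targetCartan := by
  have h1 : TensorProduct.map G.inv G.inv (G.comul 1) = G.comul 1 := by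
    rw [← hG.comul_inv, hG.inv_one]
  constructor
  · rw [hG.comul_inv, hx.2, TensorProduct.map_antimul hG.inv_mul hG.inv_mul, h1,
      TensorProduct.map_tmul, hG.inv_one]
  · rw [hG.comul_inv, hx.1, TensorProduct.map_antimul hG.inv_mul hG.inv_mul, h1,
      TensorProduct.map_tmul, hG.inv_one]

/-- `Δ` is injective, and between two copies of `Δ(1)` the elements `x` and `y` act on different
legs. -/
lemma commute_of_mem (hG : G.IsCStarQuantumGroupoid) {x y : A} (hx : x ∈ G.targetCartan)
    (hy : y ∈ G.sourceCartan) : x * y = y * x := by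
  apply hG.comul_injective
  calc G.comul (x * y)
      = G.comul 1 * (x ⊗ₜ[ℂ] (1 : A)) * (((1 : A) ⊗ₜ[ℂ] y) * G.comul 1) := by
        rw [hG.comul_mul, ← hx.1, ← hy.2]
    _ = G.comul 1 * ((1 : A) ⊗ₜ[ℂ] y) * ((x ⊗ₜ[ℂ] (1 : A)) * G.comul 1) := by
        rw [mul_assoc, mul_assoc, ← mul_assoc (x ⊗ₜ[ℂ] (1 : A)), ← mul_assoc ((1 : A) ⊗ₜ[ℂ] y)]
        simp
    _ = G.comul (y * x) := by rw [hG.comul_mul, ← hx.2, ← hy.1]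

/-- The source Cartan subalgebra as a subspace. -/
def sourceSubmodule (_ : G.IsCStarQuantumGroupoid) : Submodule ℂ A where
  carrier := G.sourceCartan
  add_mem' := by
    rintro x y ⟨hx, hx'⟩ ⟨hy, hy'⟩
    constructor
    · rw [map_add, hx, hy, TensorProduct.tmul_add, mul_add]
    · rw [map_add, hx', hy', TensorProduct.tmul_add, add_mul]
  zero_mem' := by constructor <;> simp
  smul_mem' := by
    rintro c x ⟨hx, hx'⟩
    constructor
    · rw [map_smul, hx, TensorProduct.tmul_smul, mul_smul_comm]
    · rw [map_smul, hx', TensorProduct.tmul_smul, smul_mul_assoc]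

lemma mem_sourceSubmodule (hG : G.IsCStarQuantumGroupoid) {x : A} :
    x ∈ hG.sourceSubmodule ↔ x ∈ G.sourceCartan := Iff.rfl

lemma map_antipode_comul (hG : G.IsCStarQuantumGroupoid) (a : A) :
    G.comul (G.antipode a) = TensorProduct.comm ℂ A A
      (TensorProduct.map G.antipode.toLinearMap G.antipode.toLinearMap (G.comul a)) := by
  rw [hG.antipode_comul, TensorProduct.comm_comm]

lemma comm_map_antipode_mul (hG : G.IsCStarQuantumGroupoid) (x y : A ⊗[ℂ] A) :
    TensorProduct.comm ℂ A A
        (TensorProduct.map G.antipode.toLinearMap G.antipode.toLinearMap (x * y)) =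
      TensorProduct.comm ℂ A A
        (TensorProduct.map G.antipode.toLinearMap G.antipode.toLinearMap y) *
      TensorProduct.comm ℂ A A
        (TensorProduct.map G.antipode.toLinearMap G.antipode.toLinearMap x) := by
  rw [TensorProduct.map_antimul (f := G.antipode.toLinearMap) (g := G.antipode.toLinearMap)
    hG.antipode_mul hG.antipode_mul, TensorProduct.comm_mul]

lemma comm_map_antipode_comul_one (hG : G.IsCStarQuantumGroupoid) :
    TensorProduct.comm ℂ A A
      (TensorProduct.map G.antipode.toLinearMap G.antipode.toLinearMap (G.comul 1)) =
    G.comul 1 := by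
  rw [← hG.map_antipode_comul, hG.antipode_one]

/-- The flip composed with `κ ⊗ κ` reverses products, exchanges the legs and fixes `Δ(1)`, so it
turns one set of defining identities into the other. -/
lemma antipode_mem_source (hG : G.IsCStarQuantumGroupoid) {x : A} (hx : x ∈ G.targetCartan) :
    G.antipode x ∈ G.sourceCartan := by
  constructor
  · rw [hG.map_antipode_comul, hx.2, hG.comm_map_antipode_mul, hG.comm_map_antipode_comul_one]
    simp [hG.antipode_one]
  · rw [hG.map_antipode_comul, hx.1, hG.comm_map_antipode_mul, hG.comm_map_antipode_comul_one]
    simp [hG.antipode_one]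

lemma comm_map_antipode_injective : Function.Injective fun z => TensorProduct.comm ℂ A A
    (TensorProduct.map G.antipode.toLinearMap G.antipode.toLinearMap z) :=
  (TensorProduct.comm ℂ A A).injective.comp (TensorProduct.congr G.antipode G.antipode).injective

lemma antipode_symm_mem_source (hG : G.IsCStarQuantumGroupoid) {x : A}
    (hx : x ∈ G.targetCartan) : G.antipode.symm x ∈ G.sourceCartan := by
  obtain ⟨y, rfl⟩ := G.antipode.surjective x
  rw [LinearEquiv.symm_apply_apply]
  constructor <;> apply comm_map_antipode_injective (G := G) <;> dsimp only <;>
    rw [← hG.map_antipode_comul, hG.comm_map_antipode_mul, hG.comm_map_antipode_comul_one]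
  · rw [hx.2]; simp [hG.antipode_one]
  · rw [hx.1]; simp [hG.antipode_one]

lemma antipode_symm_mem_target (hG : G.IsCStarQuantumGroupoid) {x : A}
    (hx : x ∈ G.sourceCartan) : G.antipode.symm x ∈ G.targetCartan := by
  obtain ⟨y, rfl⟩ := G.antipode.surjective x
  rw [LinearEquiv.symm_apply_apply]
  constructor <;> apply comm_map_antipode_injective (G := G) <;> dsimp only <;>
    rw [← hG.map_antipode_comul, hG.comm_map_antipode_mul, hG.comm_map_antipode_comul_one]
  · rw [hx.2]; simp [hG.antipode_one]
  · rw [hx.1]; simp [hG.antipode_one]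

end IsCStarQuantumGroupoid

/-- `m ∘ (κ ⊗ y·)`, that is `a ⊗ b ↦ κ(a) y b`. -/
noncomputable def antipodeMul (G : QuantumGroupoidData A) (y : A) : A ⊗[ℂ] A →ₗ[ℂ] A :=
  LinearMap.mul' ℂ A ∘ₗ TensorProduct.map G.antipode.toLinearMap (LinearMap.mulLeft ℂ y)

@[simp]
lemma antipodeMul_tmul (G : QuantumGroupoidData A) (y a b : A) :
    G.antipodeMul y (a ⊗ₜ[ℂ] b) = G.antipode a * (y * b) := by
  simp [antipodeMul]

lemma antipodeMul_mul_tmul (hG : G.IsCStarQuantumGroupoid) (y : A) (w : A ⊗[ℂ] A) (a b : A) :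
    G.antipodeMul y (w * (a ⊗ₜ[ℂ] b)) = G.antipode a * G.antipodeMul y w * b := by
  induction w with
  | zero => simp
  | add w w' h1 h2 => simp only [add_mul, mul_add, map_add, h1, h2]
  | tmul c d => simp [hG.antipode_mul, mul_assoc]

/-- On `w (a ⊗ b)` the value is `κ(a) · (value on w) · b`, so agreement on `w` propagates to the
right ideal it generates. -/
lemma antipodeMul_mul_congr (hG : G.IsCStarQuantumGroupoid) {x y : A} {w : A ⊗[ℂ] A}
    (h : G.antipodeMul x w = G.antipodeMul y w) (z : A ⊗[ℂ] A) :
    G.antipodeMul x (w * z) = G.antipodeMul y (w * z) := by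
  induction z with
  | zero => simp
  | add z z' h1 h2 => rw [mul_add, map_add, map_add, h1, h2]
  | tmul a b => rw [antipodeMul_mul_tmul hG, antipodeMul_mul_tmul hG, h]

/-! ### Consequences of the formula for `Δ(1)`. -/

section CanonicalElement

variable {u : MatrixUnits G.targetCartan} {q : A}

lemma comulOneFormula_iff : G.ComulOneFormula u q ↔ G.comul 1 =
    TensorProduct.map G.antipode.symm.toLinearMap LinearMap.id
      (u.casimir * (q ⊗ₜ[ℂ] (1 : A))) := by
  simp [ComulOneFormula, MatrixUnits.casimir, Finset.sum_mul]

lemma ComulOneFormula.congr (h : G.ComulOneFormula u q) (v : MatrixUnits G.targetCartan) :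
    G.ComulOneFormula v q := by
  rw [comulOneFormula_iff] at h ⊢
  rwa [v.casimir_eq u]

/-- The density of the counit on the target Cartan subalgebra, with respect to the trace of its
regular representation. -/
noncomputable def counitDensity (G : QuantumGroupoidData A) (u : MatrixUnits G.targetCartan) : A :=
  ∑ γ, ∑ i, ∑ j, (1 / (u.size γ : ℂ)) • (G.counit (u.e γ j i) • u.e γ i j)

/-- Apply `i ⊗ ε` to the formula for `Δ(1)`: the result is `κ⁻¹(p q)`, and it equals 1. -/
lemma ComulOneFormula.counitDensity_mul (hG : G.IsCStarQuantumGroupoid)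
    (h : G.ComulOneFormula u q) : G.counitDensity u * q = 1 := by
  apply G.antipode.symm.injective
  have h1 := hG.counit_right 1
  rw [h] at h1
  rw [hG.antipode_symm_one, ← h1]
  simp [counitDensity, Finset.sum_mul]

lemma counitDensity_mem (hG : G.IsCStarQuantumGroupoid) : G.counitDensity u ∈ G.targetCartan := by
  rw [← hG.mem_targetSubalgebra]
  exact sum_mem fun γ _ => sum_mem fun i _ => sum_mem fun j _ =>
    Subalgebra.smul_mem _ (Subalgebra.smul_mem _ (u.e_mem γ i j) _) _

lemma ComulOneFormula.isUnit (hG : G.IsCStarQuantumGroupoid)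
    (h : G.ComulOneFormula u q) : IsUnit q := by
  have := hG.finite
  have : IsNoetherianRing A := IsNoetherianRing.of_finite ℂ A
  exact IsUnit.of_mul_eq_one_right _ (h.counitDensity_mul hG)

/-- The left inverse `counitDensity` is built from `ε` and `u` alone. -/
lemma ComulOneFormula.unique (hG : G.IsCStarQuantumGroupoid) {q' : A}
    (h : G.ComulOneFormula u q) (h' : G.ComulOneFormula u q') : q = q' := by
  have := hG.finite
  have : IsNoetherianRing A := IsNoetherianRing.of_finite ℂ A
  have hp : IsUnit (G.counitDensity u) := IsUnit.of_mul_eq_one _ (h.counitDensity_mul hG)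
  exact hp.mul_left_cancel ((h.counitDensity_mul hG).trans (h'.counitDensity_mul hG).symm)

lemma counit_eq_trace (hG : G.IsCStarQuantumGroupoid) 
    (v : MatrixUnits (hG.targetSubalgebra : Set A)) (p : hG.targetSubalgebra) 
    (hp : (p : A) = G.counitDensity v) (x : hG.targetSubalgebra) :
    G.counit x = LinearMap.trace ℂ _ (Algebra.lmul ℂ hG.targetSubalgebra (p * x)) := by
  have key : G.counit ∘ₗ hG.targetSubalgebra.val.toLinearMap =
      LinearMap.trace ℂ _ ∘ₗ (Algebra.lmul ℂ hG.targetSubalgebra).toLinearMap ∘ₗ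
        LinearMap.mulLeft ℂ p := by
    refine v.basis.ext fun ⟨δ, k, l⟩ => ?_
    -- Only the term `i = l` has nonzero trace; its trace `n_δ` cancels the weight `1/n_δ`.
    have hmul : p * v.basis ⟨δ, k, l⟩ =
        ∑ i, (1 / (v.size δ : ℂ)) • (G.counit (v.e δ k i) • v.basis ⟨δ, i, l⟩) := by
      apply Subtype.ext
      rw [Subalgebra.coe_mul, hp, AddSubmonoidClass.coe_finsetSum]
      dsimp only [counitDensity]
      rw [Finset.sum_mul,
        Finset.sum_eq_single δ]
      · simp [MatrixUnits.basis_apply, v.mul_same, Finset.sum_mul]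
      · intro γ _ h
        simp [Finset.sum_mul, MatrixUnits.basis_apply, v.mul_of_ne γ δ h]
      · simp
    simp only [LinearMap.comp_apply, LinearMap.mulLeft_apply, hmul, map_sum, map_smul,
      AlgHom.toLinearMap_apply, v.trace_lmul, Subalgebra.val_apply, MatrixUnits.basis_apply]
    simp [mul_comm, v.size_ne_zero δ]
  exact LinearMap.congr_fun key x

lemma ComulOneFormula.positive (hG : G.IsCStarQuantumGroupoid)
    (h : G.ComulOneFormula u q) : G.IsPositive q := by
  have := hG.finite
  obtain ⟨ν, hν⟩ := hG.cstar
  obtain ⟨c, hc⟩ := exists_inv_mul_self_of_trace_lmul (B := hG.targetSubalgebra)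
    { toFun := fun x => ⟨G.inv x, hG.inv_mem_target x.2⟩
      map_add' := fun x y => Subtype.ext (map_add G.inv _ _)
      map_smul' := fun c x => Subtype.ext (LinearMap.map_smulₛₗ G.inv c _) }
    (fun a => Subtype.ext (hG.inv_inv a)) (fun a b => Subtype.ext (hG.inv_mul a b))
    (ν.restriction hG.targetSubalgebra) (fun a => hν a)
    (G.counit ∘ₗ hG.targetSubalgebra.val.toLinearMap) (fun a => hG.counit_nonneg a)
    ⟨G.counitDensity u, counitDensity_mem hG⟩ (counit_eq_trace hG u _ rfl)
  have hc' : G.counitDensity u = G.inv c * c := congrArg Subtype.val hc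
  have hself : G.inv (G.counitDensity u) = G.counitDensity u := by
    rw [hc', hG.inv_mul, hG.inv_inv]
  have hq_inv : G.inv q * G.counitDensity u = 1 := by
    rw [← hself, ← hG.inv_mul, h.counitDensity_mul hG, hG.inv_one]
  -- With `p = c* c` and `p q = 1`, `(cq)*(cq) = q* p q = q*`, and `q* = q` because `p` is
  -- self-adjoint.
  refine ⟨c * q, ?_⟩
  rw [hG.inv_mul, mul_assoc, ← mul_assoc (G.inv c), ← hc', h.counitDensity_mul hG, mul_one]
  exact (left_inv_eq_right_inv hq_inv (h.counitDensity_mul hG)).symm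

/-- The exchange rule `C (1 ⊗ x) = (x ⊗ 1) C`, seen through `κ⁻¹ ⊗ i`, which turns left factors of
the first leg into right factors. -/
lemma ComulOneFormula.comul_one_mul_one_tmul (hG : G.IsCStarQuantumGroupoid)
    (h : G.ComulOneFormula u q) {x : A} (hx : x ∈ G.targetCartan) :
    G.comul 1 * ((1 : A) ⊗ₜ[ℂ] x) = G.comul 1 * (G.antipode.symm x ⊗ₜ[ℂ] (1 : A)) := by
  have hF1 : ∀ z : A ⊗[ℂ] A, TensorProduct.map G.antipode.symm.toLinearMap LinearMap.id
      (z * ((1 : A) ⊗ₜ[ℂ] x)) = TensorProduct.map G.antipode.symm.toLinearMap LinearMap.id z *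
        ((1 : A) ⊗ₜ[ℂ] x) := by
    intro z
    induction z with
    | zero => simp
    | add z z' h1 h2 => simp only [add_mul, map_add, h1, h2]
    | tmul a b => simp
  have hF2 : ∀ z : A ⊗[ℂ] A, TensorProduct.map G.antipode.symm.toLinearMap LinearMap.id
      ((x ⊗ₜ[ℂ] (1 : A)) * z) = TensorProduct.map G.antipode.symm.toLinearMap LinearMap.id z *
        (G.antipode.symm x ⊗ₜ[ℂ] (1 : A)) := by
    intro z
    induction z with
    | zero => simp
    | add z z' h1 h2 => simp only [add_mul, mul_add, map_add, h1, h2]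
    | tmul a b => simp [hG.antipode_symm_mul]
  rw [comulOneFormula_iff.1 h, ← hF1, ← hF2, mul_assoc, ← mul_assoc (x ⊗ₜ[ℂ] (1 : A)),
    u.tmul_one_mul_casimir hx, mul_assoc]
  simp

lemma ComulOneFormula.one_tmul_mul_comul_one (hG : G.IsCStarQuantumGroupoid)
    (h : G.ComulOneFormula u q) {x : A} (hx : x ∈ G.targetCartan) :
    ((1 : A) ⊗ₜ[ℂ] x) * G.comul 1 = (G.antipode x ⊗ₜ[ℂ] (1 : A)) * G.comul 1 := by
  have h1 := congrArg (fun z => TensorProduct.comm ℂ A A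
    (TensorProduct.map G.antipode.toLinearMap G.antipode.toLinearMap z))
    (h.comul_one_mul_one_tmul hG hx)
  rw [hG.comm_map_antipode_mul, hG.comm_map_antipode_mul, hG.comm_map_antipode_comul_one] at h1
  simpa [hG.antipode_one] using h1.symm

lemma ComulOneFormula.antipode_antipode (hG : G.IsCStarQuantumGroupoid) {q : Aˣ}
    (h : G.ComulOneFormula u q) {x : A} (hx : x ∈ G.targetCartan) :
    G.antipode (G.antipode x) = ((q⁻¹ : Aˣ) : A) * x * q := by
  have hF1 : ∀ z : A ⊗[ℂ] A, TensorProduct.map G.antipode.symm.toLinearMap LinearMap.id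
      (((1 : A) ⊗ₜ[ℂ] x) * z) = ((1 : A) ⊗ₜ[ℂ] x) *
        TensorProduct.map G.antipode.symm.toLinearMap LinearMap.id z := by
    intro z
    induction z with
    | zero => simp
    | add z z' h1 h2 => simp only [mul_add, map_add, h1, h2]
    | tmul a b => simp
  have hF2 : ∀ (y : A) (z : A ⊗[ℂ] A), TensorProduct.map G.antipode.symm.toLinearMap LinearMap.id
      (z * (y ⊗ₜ[ℂ] (1 : A))) = (G.antipode.symm y ⊗ₜ[ℂ] (1 : A)) *
        TensorProduct.map G.antipode.symm.toLinearMap LinearMap.id z := by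
    intro y z
    induction z with
    | zero => simp
    | add z z' h1 h2 => simp only [add_mul, mul_add, map_add, h1, h2]
    | tmul a b => simp [hG.antipode_symm_mul]
  -- Since `(1 ⊗ x) C (q ⊗ 1) = C (xq ⊗ 1) = C (q ⊗ 1)(q⁻¹xq ⊗ 1)`. Comparing with `(κ(x) ⊗ 1)Δ(1)`
  -- identifies the first legs.
  have h1 : ((1 : A) ⊗ₜ[ℂ] x) * G.comul 1 =
      (G.antipode.symm (((q⁻¹ : Aˣ) : A) * x * q) ⊗ₜ[ℂ] (1 : A)) * G.comul 1 := by
    rw [comulOneFormula_iff.1 h, ← hF1, ← hF2, ← mul_assoc, ← u.casimir_mul_tmul_one hx, mul_assoc,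
      mul_assoc]
    simp [← mul_assoc]
  have h2 := hG.tmul_one_mul_comul_one_injective
    ((h.one_tmul_mul_comul_one hG hx).symm.trans h1)
  rw [h2, LinearEquiv.apply_symm_apply]

/-- `κ(1₁) y 1₂ = E(q y)`. -/
lemma ComulOneFormula.antipodeMul_comul_one (h : G.ComulOneFormula u q) (y : A) :
    G.antipodeMul y (G.comul 1) = u.centerExpectation (q * y) := by
  rw [h]
  simp [MatrixUnits.centerExpectation, mul_assoc]

lemma ComulOneFormula.comul_one_mul_one_tmul_mul_comul_one (hG : G.IsCStarQuantumGroupoid)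
    (hq : q ∈ G.targetCartan) (h : G.ComulOneFormula u q) (x : A) :
    G.comul 1 * ((1 : A) ⊗ₜ[ℂ] x) * G.comul 1 =
      G.comul 1 * ((1 : A) ⊗ₜ[ℂ] u.centerExpectation (q * x)) := by
  -- Expand the right-hand `Δ(1)`: its first leg passes `1 ⊗ x` and, on meeting the left-hand
  -- `Δ(1)`, reappears in the second leg as `e q`.
  have key : ∀ γ i j, G.comul 1 * ((1 : A) ⊗ₜ[ℂ] x) *
      (G.antipode.symm (u.e γ i j * q) ⊗ₜ[ℂ] u.e γ j i) =
        G.comul 1 * ((1 : A) ⊗ₜ[ℂ] (u.e γ i j * (q * x) * u.e γ j i)) := by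
    intro γ i j
    have h1 : ((1 : A) ⊗ₜ[ℂ] x) * (G.antipode.symm (u.e γ i j * q) ⊗ₜ[ℂ] u.e γ j i) =
        (G.antipode.symm (u.e γ i j * q) ⊗ₜ[ℂ] (1 : A)) * ((1 : A) ⊗ₜ[ℂ] (x * u.e γ j i)) := by
      simp
    rw [mul_assoc, h1, ← mul_assoc,
      ← h.comul_one_mul_one_tmul hG (hG.mul_mem_target (u.e_mem γ i j) hq), mul_assoc]
    simp [mul_assoc]
  calc G.comul 1 * ((1 : A) ⊗ₜ[ℂ] x) * G.comul 1
      = ∑ γ, ∑ i, ∑ j, (1 / (u.size γ : ℂ)) • (G.comul 1 * ((1 : A) ⊗ₜ[ℂ] x) *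
          (G.antipode.symm (u.e γ i j * q) ⊗ₜ[ℂ] u.e γ j i)) := by
        nth_rewrite 2 [h]
        simp only [Finset.mul_sum, mul_smul_comm]
    _ = _ := by
        simp only [key, MatrixUnits.centerExpectation, TensorProduct.tmul_sum,
          TensorProduct.tmul_smul, Finset.mul_sum, mul_smul_comm]

lemma ComulOneFormula.centerExpectation_eq_one (hG : G.IsCStarQuantumGroupoid)
    (hq : q ∈ G.targetCartan) (h : G.ComulOneFormula u q) : u.centerExpectation q = 1 := by
  have h1 := h.comul_one_mul_one_tmul_mul_comul_one hG hq 1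
  rw [← Algebra.TensorProduct.one_def, mul_one, hG.comul_mul_comul_one, mul_one] at h1
  refine (hG.comul_one_mul_one_tmul_injective ?_).symm
  rw [← h1, ← Algebra.TensorProduct.one_def, mul_one]

/-- An element of the target Cartan subalgebra with the first property of the canonical element
has all of them. -/
theorem ComulOneFormula.isCanonicalElement (hG : G.IsCStarQuantumGroupoid)
    (hq : q ∈ G.targetCartan) (h : G.ComulOneFormula u q) : G.IsCanonicalElement q := by
  have hpos := h.positive hG
  obtain ⟨q, rfl⟩ := h.isUnit hG
  have hq_inv := hG.units_inv_mem_target hq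
  refine ⟨hq, q.isUnit, h.congr, ?_, fun v => (h.congr v).centerExpectation_eq_one hG hq, ?_, hpos⟩
  · rw [h.antipode_antipode hG hq, q.inv_mul, one_mul]
  · obtain ⟨s, hs, hs'⟩ : ∃ s : Aˣ, (s : A) = G.antipode q ∧
        ((s⁻¹ : Aˣ) : A) = G.antipode ((q⁻¹ : Aˣ) : A) :=
      ⟨⟨G.antipode q, G.antipode ((q⁻¹ : Aˣ) : A),
        by rw [← hG.antipode_mul, q.inv_mul, hG.antipode_one],
        by rw [← hG.antipode_mul, q.mul_inv, hG.antipode_one]⟩, rfl, rfl⟩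
    have hs_mem : (s : A) ∈ G.sourceCartan := hs ▸ hG.antipode_mem_source hq
    have hqs : Commute q s := Units.ext (hG.commute_of_mem hq hs_mem)
    rw [Ring.inverse_unit, ← hs, ← hs']
    -- The target formula is conjugation by `q⁻¹ κ(q)`. Both sides are then multiplicative, so
    -- generators suffice: `κ(q)` acts trivially on `A_t`, and `q` on `A_s`.
    have hconj : ∀ x : A, ((q⁻¹ : Aˣ) : A) * s * x * q * ((s⁻¹ : Aˣ) : A) =
        ((q⁻¹ * s : Aˣ) : A) * x * (((q⁻¹ * s)⁻¹ : Aˣ) : A) := by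
      intro x
      rw [mul_inv_rev, inv_inv, ← hqs.inv_right.eq, Units.val_mul, Units.val_mul]
      simp only [mul_assoc]
    simp only [hconj]
    intro x hx
    induction hx using Algebra.adjoin_induction with
    | mem x hx =>
      rcases hx with hx | hx
      · rw [h.antipode_antipode hG hx, mul_inv_rev, inv_inv, Units.val_mul, Units.val_mul,
          mul_assoc _ (s : A), ← hG.commute_of_mem hx hs_mem]
        simp [mul_assoc]
      · have hx' := hG.antipode_symm_mem_target hx
        have h1 := congrArg G.antipode (h.antipode_antipode hG hx')
        rw [hG.antipode_mul, hG.antipode_mul, LinearEquiv.apply_symm_apply, ← hs, ← hs'] at h1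
        rw [h1, hqs.inv_left.eq, mul_inv_rev, inv_inv, Units.val_mul, Units.val_mul,
          mul_assoc (s : A), hG.commute_of_mem hq_inv hx]
        simp [mul_assoc]
    | algebraMap c =>
      rw [Algebra.algebraMap_eq_smul_one, map_smul, map_smul, hG.antipode_one, hG.antipode_one,
        mul_smul_comm, smul_mul_assoc, mul_one, Units.mul_inv]
    | add x y _ _ hx hy => simp only [map_add, mul_add, add_mul, hx, hy]
    | mul x y _ _ hx hy =>
      rw [hG.antipode_mul, hG.antipode_mul, hx, hy]
      simp only [mul_assoc, Units.inv_mul_cancel_left]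

end CanonicalElement

/-! ### The deformed structure. -/

variable {k : Aˣ}

lemma deform_inv (a : A) : (G.deform k).inv a = k * G.inv a * ((k⁻¹ : Aˣ) : A) := rfl

lemma deform_comul (a : A) :
    (G.deform k).comul a = G.comul a * ((1 : A) ⊗ₜ[ℂ] ((k⁻¹ : Aˣ) : A)) := rfl

lemma deform_antipode (a : A) :
    (G.deform k).antipode a = k * G.antipode a * ((k⁻¹ : Aˣ) : A) := rfl

lemma deform_antipode_symm (a : A) :
    (G.deform k).antipode.symm a = G.antipode.symm (((k⁻¹ : Aˣ) : A) * a * k) := rfl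

lemma deform_counit (a : A) : (G.deform k).counit a = G.counit (a * k) := rfl

lemma map_deform_inv (z : A ⊗[ℂ] A) :
    TensorProduct.map (G.deform k).inv (G.deform k).inv z =
      ((k : A) ⊗ₜ[ℂ] (k : A)) * TensorProduct.map G.inv G.inv z *
        (((k⁻¹ : Aˣ) : A) ⊗ₜ[ℂ] ((k⁻¹ : Aˣ) : A)) := by
  induction z with
  | zero => simp
  | add x y hx hy => simp only [map_add, mul_add, add_mul, hx, hy]
  | tmul a b => simp [deform_inv]

lemma map_deform_antipode (z : A ⊗[ℂ] A) :
    TensorProduct.map (G.deform k).antipode.toLinearMap (G.deform k).antipode.toLinearMap z =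
      ((k : A) ⊗ₜ[ℂ] (k : A)) *
        TensorProduct.map G.antipode.toLinearMap G.antipode.toLinearMap z *
        (((k⁻¹ : Aˣ) : A) ⊗ₜ[ℂ] ((k⁻¹ : Aˣ) : A)) := by
  induction z with
  | zero => simp
  | add x y hx hy => simp only [map_add, mul_add, add_mul, hx, hy]
  | tmul a b => simp [deform_antipode]

lemma mul_one_tmul_inv_injective :
    Function.Injective fun z : A ⊗[ℂ] A => z * ((1 : A) ⊗ₜ[ℂ] ((k⁻¹ : Aˣ) : A)) := by
  refine Function.LeftInverse.injective (g := fun z => z * ((1 : A) ⊗ₜ[ℂ] (k : A))) fun z => ?_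
  simp [mul_assoc, ← Algebra.TensorProduct.one_def]

/-- The extra factor `1 ⊗ k⁻¹` commutes with `x ⊗ 1` and can be cancelled. -/
lemma deform_targetCartan : (G.deform k).targetCartan = G.targetCartan := by
  ext x
  have hswap : ((1 : A) ⊗ₜ[ℂ] ((k⁻¹ : Aˣ) : A)) * (x ⊗ₜ[ℂ] (1 : A)) =
      (x ⊗ₜ[ℂ] (1 : A)) * ((1 : A) ⊗ₜ[ℂ] ((k⁻¹ : Aˣ) : A)) := by simp
  have hinj := mul_one_tmul_inv_injective (A := A) (k := k)
  simp only [targetCartan, Set.mem_ofPred_eq, deform_comul]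
  rw [mul_assoc (G.comul 1), hswap, ← mul_assoc, ← mul_assoc]
  exact and_congr hinj.eq_iff hinj.eq_iff

/-- If `k = b* b`, take `h = b*`, which has the right inverse `b k⁻¹` and so is a unit by finite
dimension. -/
lemma exists_factor_of_isPositive (hG : G.IsCStarQuantumGroupoid) (hk : G.IsPositive (k : A)) :
    ∃ h : Aˣ, (k : A) = h * G.inv h ∧
      ((k⁻¹ : Aˣ) : A) = G.inv ((h⁻¹ : Aˣ) : A) * ((h⁻¹ : Aˣ) : A) := by
  have := hG.finite
  have : IsNoetherianRing A := IsNoetherianRing.of_finite ℂ A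
  obtain ⟨b, hb⟩ := hk
  have hb_unit : IsUnit (G.inv b) :=
    IsUnit.of_mul_eq_one (b * ((k⁻¹ : Aˣ) : A)) (by rw [← mul_assoc, ← hb, k.mul_inv])
  obtain ⟨h, hh⟩ := hb_unit
  have hkh : (k : A) = h * G.inv h := by rw [hb, hh, hG.inv_inv]
  refine ⟨h, hkh, left_inv_eq_right_inv k.inv_mul ?_⟩
  rw [hkh, mul_assoc, ← mul_assoc (G.inv h), ← hG.inv_mul, h.inv_mul, hG.inv_one, one_mul,
    h.mul_inv]

/-- With `k = h h*`, the map `a ↦ h⁻¹ a h` turns the deformed involution into the given one. -/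
lemma deform_cstar (hG : G.IsCStarQuantumGroupoid) (hk : G.IsPositive (k : A)) :
    ∃ ν : AlgebraNorm ℂ A, ∀ a, ν ((G.deform k).inv a * a) = ν a ^ 2 := by
  obtain ⟨ν, hν⟩ := hG.cstar
  obtain ⟨h, hh, hh'⟩ := exists_factor_of_isPositive hG hk
  have hinj : ∀ x : A, ((h⁻¹ : Aˣ) : A) * x * h = 0 → x = 0 := by
    intro x hx
    have : x = h * (((h⁻¹ : Aˣ) : A) * x * h) * ((h⁻¹ : Aˣ) : A) := by simp [mul_assoc]
    rw [this, hx, mul_zero, zero_mul]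
  refine ⟨{ toFun := fun a => ν (((h⁻¹ : Aˣ) : A) * a * h)
            map_zero' := by simp
            add_le' := fun x y => by rw [mul_add, add_mul]; exact map_add_le_add ν _ _
            neg' := fun x => by rw [mul_neg, neg_mul]; exact map_neg_eq_map ν _
            mul_le' := fun x y => ?_
            eq_zero_of_map_eq_zero' := fun x hx => hinj x (eq_zero_of_map_eq_zero ν hx)
            smul' := fun c x => by
              rw [mul_smul_comm, smul_mul_assoc]; exact map_smul_eq_mul ν c _ }, fun a => ?_⟩
  · have : ((h⁻¹ : Aˣ) : A) * (x * y) * h =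
        (((h⁻¹ : Aˣ) : A) * x * h) * (((h⁻¹ : Aˣ) : A) * y * h) := by simp [mul_assoc]
    rw [this]
    exact map_mul_le_mul ν _ _
  · have h3 : ((h⁻¹ : Aˣ) : A) * ((G.deform k).inv a * a) * h =
        G.inv (((h⁻¹ : Aˣ) : A) * a * h) * (((h⁻¹ : Aˣ) : A) * a * h) := by
      rw [deform_inv, hG.inv_mul, hG.inv_mul, hh', hh]
      simp [mul_assoc]
    exact (congrArg ν h3).trans (hν _)

variable {u : MatrixUnits G.targetCartan} {q : A}

lemma assoc_mul_one_tmul_tmul (z : A ⊗[ℂ] A) (b y : A) :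
    TensorProduct.assoc ℂ A A A ((z * ((1 : A) ⊗ₜ[ℂ] y)) ⊗ₜ[ℂ] (b * y)) =
      TensorProduct.assoc ℂ A A A (z ⊗ₜ[ℂ] b) * ((1 : A) ⊗ₜ[ℂ] (y ⊗ₜ[ℂ] y)) := by
  induction z with
  | zero => simp
  | add x x' hx hx' => simp only [add_mul, TensorProduct.add_tmul, map_add, hx, hx']
  | tmul c d => simp

lemma assoc_map_deform_comul (z : A ⊗[ℂ] A) :
    TensorProduct.assoc ℂ A A A (TensorProduct.map (G.deform k).comul LinearMap.id
      (z * ((1 : A) ⊗ₜ[ℂ] ((k⁻¹ : Aˣ) : A)))) =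
    TensorProduct.assoc ℂ A A A (TensorProduct.map G.comul LinearMap.id z) *
      ((1 : A) ⊗ₜ[ℂ] (((k⁻¹ : Aˣ) : A) ⊗ₜ[ℂ] ((k⁻¹ : Aˣ) : A))) := by
  induction z with
  | zero => simp
  | add x x' hx hx' => simp only [add_mul, map_add, hx, hx']
  | tmul c d =>
    rw [Algebra.TensorProduct.tmul_mul_tmul, mul_one, TensorProduct.map_tmul, deform_comul,
      LinearMap.id_apply, assoc_mul_one_tmul_tmul, TensorProduct.map_tmul, LinearMap.id_apply]

/-- Here `k ∈ A_t` matters: `Δ(d k⁻¹) = Δ(d)(k⁻¹ ⊗ 1)` produces the same factor `1 ⊗ k⁻¹ ⊗ k⁻¹` as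
the other side of coassociativity. -/
lemma map_id_deform_comul (hG : G.IsCStarQuantumGroupoid) (hk : (k : A) ∈ G.targetCartan)
    (z : A ⊗[ℂ] A) :
    TensorProduct.map LinearMap.id (G.deform k).comul (z * ((1 : A) ⊗ₜ[ℂ] ((k⁻¹ : Aˣ) : A))) =
      TensorProduct.map LinearMap.id G.comul z *
        ((1 : A) ⊗ₜ[ℂ] (((k⁻¹ : Aˣ) : A) ⊗ₜ[ℂ] ((k⁻¹ : Aˣ) : A))) := by
  induction z with
  | zero => simp
  | add x x' hx hx' => simp only [add_mul, map_add, hx, hx']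
  | tmul c d =>
    rw [Algebra.TensorProduct.tmul_mul_tmul, mul_one, TensorProduct.map_tmul, deform_comul,
      LinearMap.id_apply, hG.comul_mul_target d (hG.units_inv_mem_target hk), mul_assoc]
    simp

lemma map_deform_counit_id (z : A ⊗[ℂ] A) :
    TensorProduct.map (G.deform k).counit (LinearMap.id : A →ₗ[ℂ] A) z =
      TensorProduct.map G.counit LinearMap.id (z * ((k : A) ⊗ₜ[ℂ] (1 : A))) := by
  induction z with
  | zero => simp
  | add x x' hx hx' => simp only [add_mul, map_add, hx, hx']
  | tmul c d => simp [deform_counit]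

lemma map_id_deform_counit (z : A ⊗[ℂ] A) :
    TensorProduct.map (LinearMap.id : A →ₗ[ℂ] A) (G.deform k).counit z =
      TensorProduct.map LinearMap.id G.counit (z * ((1 : A) ⊗ₜ[ℂ] (k : A))) := by
  induction z with
  | zero => simp
  | add x x' hx hx' => simp only [add_mul, map_add, hx, hx']
  | tmul c d => simp [deform_counit]

lemma map_deform_counit (z : A ⊗[ℂ] A) :
    TensorProduct.map (G.deform k).counit (G.deform k).counit z =
      TensorProduct.map G.counit G.counit (z * ((k : A) ⊗ₜ[ℂ] (k : A))) := by
  induction z with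
  | zero => simp
  | add x x' hx hx' => simp only [add_mul, map_add, hx, hx']
  | tmul c d => simp [deform_counit]

lemma mul'_map_deform_antipode (z : A ⊗[ℂ] A) :
    LinearMap.mul' ℂ A (TensorProduct.map (G.deform k).antipode.toLinearMap LinearMap.id
      (z * ((1 : A) ⊗ₜ[ℂ] ((k⁻¹ : Aˣ) : A)))) =
      k * G.antipodeMul ((k⁻¹ : Aˣ) : A) z * ((k⁻¹ : Aˣ) : A) := by
  induction z with
  | zero => simp
  | add x x' hx hx' => simp only [add_mul, mul_add, map_add, hx, hx']
  | tmul c d => simp [deform_antipode, mul_assoc]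


lemma isCStarQuantumGroupoid_deform (hG : G.IsCStarQuantumGroupoid)
    (hq : q ∈ G.targetCartan) (hq_formula : G.ComulOneFormula u q)
    (hk : (k : A) ∈ G.targetCartan) (hk_pos : G.IsPositive (k : A))
    (hk_exp : u.centerExpectation (q * ((k⁻¹ : Aˣ) : A)) = 1) :
    (G.deform k).IsCStarQuantumGroupoid := by
  have hk_inv := hG.units_inv_mem_target hk
  have hself : G.inv (k : A) = k := by
    obtain ⟨b, hb⟩ := hk_pos
    rw [hb, hG.inv_mul, hG.inv_inv]
  have hself' : G.inv ((k⁻¹ : Aˣ) : A) = ((k⁻¹ : Aˣ) : A) := by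
    refine left_inv_eq_right_inv (a := (k : A)) ?_ k.mul_inv
    rw [show G.inv ((k⁻¹ : Aˣ) : A) * k = G.inv ((k⁻¹ : Aˣ) : A) * G.inv k by rw [hself]]
    rw [← hG.inv_mul, k.mul_inv, hG.inv_one]
  -- Insert `Δ(1)` on both sides of `1 ⊗ k⁻¹`; the compression is then `Δ(1)(1 ⊗ E(q k⁻¹)) = Δ(1)`.
  have hmid : ∀ a b : A, G.comul a * ((1 : A) ⊗ₜ[ℂ] ((k⁻¹ : Aˣ) : A)) * G.comul b =
      G.comul a * G.comul b := by
    intro a b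
    rw [← hG.comul_mul_comul_one a, ← hG.comul_one_mul_comul b, ← mul_assoc,
      mul_assoc (G.comul a), mul_assoc (G.comul a),
      hq_formula.comul_one_mul_one_tmul_mul_comul_one hG hq, hk_exp,
      ← Algebra.TensorProduct.one_def, mul_one]
    simp only [mul_assoc, hG.comul_one_mul_comul]
  refine
    { finite := hG.finite
      inv_inv := fun a => ?_
      inv_mul := fun a b => ?_
      cstar := deform_cstar hG hk_pos
      comul_mul := fun a b => ?_
      comul_inv := fun a => ?_
      coassoc := fun a => ?_
      antipode_inv := fun a => ?_
      antipode_mul := fun a b => ?_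
      antipode_comul := fun a => ?_
      antipode_comul_comul := fun x => ?_
      counit_nonneg := fun a => ?_
      counit_left := fun a => ?_
      counit_right := fun a => ?_
      counit_mul := fun x y => ?_ }
  · simp [deform_inv, hG.inv_mul, hG.inv_inv, hself, hself', mul_assoc]
  · simp [deform_inv, hG.inv_mul, mul_assoc]
  · simp only [deform_comul, hG.comul_mul, ← mul_assoc, hmid]
  · rw [deform_comul, deform_comul, map_deform_inv, deform_inv, hG.comul_mul_target _ hk_inv, hG.comul_target_mul _ hk,
      TensorProduct.map_antimul hG.inv_mul hG.inv_mul, TensorProduct.map_tmul, hG.inv_one, hself',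
      hG.comul_inv, mul_assoc _ (((k⁻¹ : Aˣ) : A) ⊗ₜ[ℂ] (1 : A))]
    simp [← mul_assoc]
  · rw [deform_comul, assoc_map_deform_comul, map_id_deform_comul hG hk, hG.coassoc]
  · have h1 : G.antipode (G.inv (G.antipode (k : A))) = k := by
      rw [show G.antipode (k : A) = G.antipode (G.inv k) by rw [hself], hG.antipode_inv]
    have h2 : G.antipode (G.inv (G.antipode ((k⁻¹ : Aˣ) : A))) = ((k⁻¹ : Aˣ) : A) := by
      rw [show G.antipode ((k⁻¹ : Aˣ) : A) = G.antipode (G.inv ((k⁻¹ : Aˣ) : A)) by rw [hself'],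
        hG.antipode_inv]
    simp [deform_inv, deform_antipode, hG.inv_mul, hG.antipode_mul, hself, hself', h1, h2,
      hG.antipode_inv, mul_assoc]
  · simp [deform_antipode, hG.antipode_mul, mul_assoc]
  · apply (TensorProduct.comm ℂ A A).injective
    rw [TensorProduct.comm_comm, map_deform_antipode, TensorProduct.comm_mul,
      TensorProduct.comm_mul, deform_comul, deform_comul, deform_antipode,
      hG.comul_mul_target _ hk_inv, hG.comul_target_mul _ hk, hG.comm_map_antipode_mul,
      ← hG.map_antipode_comul, ← hG.comul_one_mul_comul (G.antipode a), TensorProduct.map_tmul]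
    -- Trades the factor `κ(k⁻¹)` in the first leg for `k⁻¹` in the second, where it cancels `k`.
    have h1 := hq_formula.one_tmul_mul_comul_one hG hk_inv
    simp only [LinearEquiv.coe_coe, hG.antipode_one, TensorProduct.comm_tmul]
    rw [← mul_assoc (G.antipode ((k⁻¹ : Aˣ) : A) ⊗ₜ[ℂ] (1 : A)), ← h1]
    simp only [← mul_assoc, Algebra.TensorProduct.tmul_mul_tmul, mul_one, k.mul_inv]
    simp only [mul_assoc, Algebra.TensorProduct.tmul_mul_tmul, mul_one, one_mul]
  · have h1 : ∀ a, LinearMap.mul' ℂ A (TensorProduct.map (G.deform k).antipode.toLinearMap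
        LinearMap.id ((G.deform k).comul a)) =
          k * LinearMap.mul' ℂ A (TensorProduct.map G.antipode.toLinearMap LinearMap.id
            (G.comul a)) * ((k⁻¹ : Aˣ) : A) := by
      intro a
      -- The `k⁻¹` caught between the legs can be dropped because `E(q k⁻¹) = 1 = E(q)`.
      have h2 : G.antipodeMul ((k⁻¹ : Aˣ) : A) (G.comul 1) = G.antipodeMul 1 (G.comul 1) := by
        rw [hq_formula.antipodeMul_comul_one, hq_formula.antipodeMul_comul_one, hk_exp, mul_one,
          hq_formula.centerExpectation_eq_one hG hq]
      rw [deform_comul, mul'_map_deform_antipode, ← hG.comul_one_mul_comul a,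
        antipodeMul_mul_congr hG h2]
      simp [antipodeMul]
    have h2 : ∀ w : A ⊗[ℂ] A, TensorProduct.map
        (LinearMap.mul' ℂ A ∘ₗ TensorProduct.map (G.deform k).antipode.toLinearMap LinearMap.id)
        LinearMap.id (TensorProduct.map (G.deform k).comul LinearMap.id
          (w * ((1 : A) ⊗ₜ[ℂ] ((k⁻¹ : Aˣ) : A)))) =
        ((k : A) ⊗ₜ[ℂ] (1 : A)) * TensorProduct.map
          (LinearMap.mul' ℂ A ∘ₗ TensorProduct.map G.antipode.toLinearMap LinearMap.id)
          LinearMap.id (TensorProduct.map G.comul LinearMap.id w) *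
          (((k⁻¹ : Aˣ) : A) ⊗ₜ[ℂ] ((k⁻¹ : Aˣ) : A)) := by
      intro w
      induction w with
      | zero => simp
      | add w w' hw hw' => simp only [add_mul, mul_add, map_add, hw, hw']
      | tmul a b => simp [h1]
    rw [deform_comul, h2, hG.antipode_comul_comul, deform_comul]
    have h3 : ((k : A) ⊗ₜ[ℂ] (1 : A)) * G.comul 1 = G.comul 1 * ((k : A) ⊗ₜ[ℂ] (1 : A)) :=
      hk.2.symm.trans hk.1
    rw [← mul_assoc, Algebra.TensorProduct.tmul_mul_tmul, mul_one, one_mul,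
      show (k : A) ⊗ₜ[ℂ] x = ((1 : A) ⊗ₜ[ℂ] x) * ((k : A) ⊗ₜ[ℂ] (1 : A)) by simp,
      mul_assoc ((1 : A) ⊗ₜ[ℂ] x), h3]
    simp [mul_assoc]
  · obtain ⟨h, -, hh⟩ := exists_factor_of_isPositive hG hk_pos
    have h1 : (G.deform k).inv a * a * k =
        G.inv (((h⁻¹ : Aˣ) : A) * a * k) * (((h⁻¹ : Aˣ) : A) * a * k) := by
      rw [deform_inv, hh, hG.inv_mul, hG.inv_mul, hself]
      simp only [mul_assoc]
    rw [deform_counit, h1]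
    exact hG.counit_nonneg _
  · rw [map_deform_counit_id, deform_comul, mul_assoc,
      show ((1 : A) ⊗ₜ[ℂ] ((k⁻¹ : Aˣ) : A)) * ((k : A) ⊗ₜ[ℂ] (1 : A)) =
        ((k : A) ⊗ₜ[ℂ] (1 : A)) * ((1 : A) ⊗ₜ[ℂ] ((k⁻¹ : Aˣ) : A)) by simp,
      ← mul_assoc, ← hG.comul_mul_target a hk, TensorProduct.lid_map_mul_one_tmul, hG.counit_left,
      mul_assoc, k.mul_inv, mul_one]
  · rw [map_id_deform_counit, deform_comul, mul_assoc, Algebra.TensorProduct.tmul_mul_tmul,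
      k.inv_mul, one_mul, ← Algebra.TensorProduct.one_def, mul_one, hG.counit_right]
  · have h1 : (x ⊗ₜ[ℂ] (1 : A)) * (G.deform k).comul 1 * ((1 : A) ⊗ₜ[ℂ] y) *
        ((k : A) ⊗ₜ[ℂ] (k : A)) = ((x * k) ⊗ₜ[ℂ] (1 : A)) * G.comul 1 *
          ((1 : A) ⊗ₜ[ℂ] (((k⁻¹ : Aˣ) : A) * y * k)) := by
      rw [show (x * k) ⊗ₜ[ℂ] (1 : A) = (x ⊗ₜ[ℂ] (1 : A)) * ((k : A) ⊗ₜ[ℂ] (1 : A)) by simp,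
        mul_assoc (x ⊗ₜ[ℂ] (1 : A)) ((k : A) ⊗ₜ[ℂ] (1 : A)), ← hk.2, hk.1, deform_comul]
      simp [mul_assoc]
    rw [map_deform_counit, h1, hG.counit_mul, deform_counit]
    simp [mul_assoc]

/-- The second identity in the definition of the source Cartan subalgebra implies membership. -/
lemma ComulOneFormula.mem_source_of_comul_eq (hG : G.IsCStarQuantumGroupoid)
    (hq : q ∈ G.targetCartan) (hq_formula : G.ComulOneFormula u q) {x : A}
    (hx : G.comul x = ((1 : A) ⊗ₜ[ℂ] x) * G.comul 1) : x ∈ G.sourceCartan := by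
  -- Applying `i ⊗ ε` writes `x` as a combination of elements `κ⁻¹(e q)`, which lie in `κ⁻¹(A_t) ⊆
  -- A_s`.
  have h1 := hG.counit_right x
  rw [hx, hq_formula] at h1
  rw [← h1, ← hG.mem_sourceSubmodule]
  simp only [Finset.mul_sum, mul_smul_comm, Algebra.TensorProduct.tmul_mul_tmul, one_mul, map_sum,
    map_smul, TensorProduct.map_tmul, TensorProduct.rid_tmul, LinearMap.id_apply]
  exact sum_mem fun γ _ => sum_mem fun i _ => sum_mem fun j _ =>
    Submodule.smul_mem _ _ (Submodule.smul_mem _ _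
      (hG.antipode_symm_mem_source (hG.mul_mem_target (u.e_mem γ i j) hq)))

/-- In the second defining identity `x` stands on the left, so `k⁻¹` cancels directly. The first one
needs `x` to commute with `k⁻¹`, known only once `x ∈ A_s`. -/
lemma deform_sourceCartan (hG : G.IsCStarQuantumGroupoid)
    (hq : q ∈ G.targetCartan) (hq_formula : G.ComulOneFormula u q)
    (hk : (k : A) ∈ G.targetCartan) : (G.deform k).sourceCartan = G.sourceCartan := by
  have hinj := mul_one_tmul_inv_injective (A := A) (k := k)
  ext x
  constructor
  · rintro ⟨-, hx⟩
    refine hq_formula.mem_source_of_comul_eq hG hq (hinj ?_)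
    rwa [deform_comul, deform_comul, ← mul_assoc] at hx
  · rintro hx
    have h1 := hG.commute_of_mem (hG.units_inv_mem_target hk) hx
    constructor
    · rw [deform_comul, deform_comul, hx.1, mul_assoc, mul_assoc,
        Algebra.TensorProduct.tmul_mul_tmul, Algebra.TensorProduct.tmul_mul_tmul, h1]
    · rw [deform_comul, deform_comul, hx.2, mul_assoc]

end QuantumGroupoidData

theorem theorem2p6 {A : Type*} [Ring A] [Algebra ℂ A]
    (G : QuantumGroupoidData A) (hG : G.IsCStarQuantumGroupoid)
    (u : MatrixUnits G.targetCartan)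
    (q : A) (hq : q ∈ G.targetCartan) (hq_formula : G.ComulOneFormula u q)
    (k : Aˣ) (hk : (k : A) ∈ G.targetCartan) (hk_pos : G.IsPositive (k : A))
    (hk_sq : G.antipode (G.antipode (k : A)) = k)
    (hk_exp : u.centerExpectation (((k⁻¹ : Aˣ) : A) * q) = 1) :
    (G.deform k).IsCStarQuantumGroupoid ∧
      (G.deform k).targetCartan = G.targetCartan ∧
      (G.deform k).sourceCartan = G.sourceCartan ∧
      ∀ q' : A, (G.deform k).IsCanonicalElement q' ↔ q' = ((k⁻¹ : Aˣ) : A) * q := by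
  -- On `A_t`, `κ²` is conjugation by `q⁻¹`, so `κ²(k) = k` says that `k` and `q` commute.
  have hcomm : ((k⁻¹ : Aˣ) : A) * q = q * ((k⁻¹ : Aˣ) : A) := by
    obtain ⟨q, rfl⟩ := hq_formula.isUnit hG
    have h1 := hq_formula.antipode_antipode hG hk
    rw [hk_sq, mul_assoc, Units.eq_inv_mul_iff_mul_eq] at h1
    have h2 : Commute q k := Units.ext h1
    exact congrArg Units.val h2.inv_right.eq.symm
  have hk_inv := hG.units_inv_mem_target hk
  have hGk := QuantumGroupoidData.isCStarQuantumGroupoid_deform hG hq hq_formula hk hk_pos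
    (hcomm ▸ hk_exp)
  have htarget := QuantumGroupoidData.deform_targetCartan (G := G) (k := k)
  refine ⟨hGk, htarget, QuantumGroupoidData.deform_sourceCartan hG hq hq_formula hk, ?_⟩
  obtain ⟨v, hv⟩ : ∃ v : MatrixUnits (G.deform k).targetCartan,
      (G.deform k).ComulOneFormula v (((k⁻¹ : Aˣ) : A) * q) := by
    refine ⟨⟨u.blocks, u.size, u.size_pos, u.e, u.mul_same, u.mul_of_ne, u.sum_diag,
      u.linearIndependent, u.span_eq.trans htarget.symm⟩, ?_⟩
    have h1 : ∀ γ i j, (G.deform k).antipode.symm (u.e γ i j * (((k⁻¹ : Aˣ) : A) * q)) =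
        G.antipode.symm (u.e γ i j * q) * G.antipode.symm ((k⁻¹ : Aˣ) : A) := by
      intro γ i j
      rw [hcomm, QuantumGroupoidData.deform_antipode_symm, ← hG.antipode_symm_mul]
      simp [mul_assoc]
    unfold QuantumGroupoidData.ComulOneFormula
    simp only [h1]
    -- Moving `k⁻¹` to the first leg yields the right factor `κ⁻¹(k⁻¹)` that `h1` extracts from
    -- `κ_k⁻¹(e k⁻¹ q)`.
    rw [QuantumGroupoidData.deform_comul, hq_formula.comul_one_mul_one_tmul hG hk_inv]
    nth_rewrite 1 [hq_formula]
    simp [Finset.sum_mul]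
  have hmem : ((k⁻¹ : Aˣ) : A) * q ∈ (G.deform k).targetCartan :=
    htarget ▸ hG.mul_mem_target hk_inv hq
  intro q'
  constructor
  · intro h
    exact (h.comul_one v).unique hGk hv
  · rintro rfl
    exact hv.isCanonicalElement hGk hmem
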